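/- Let $(R,\mathfrak m)$ be a $2$-dimensional Cohen–Macaulay (Noetherian) local ring with infinite residue field, let $I$ be an $\mathfrak m$-primary ideal of $R$, and let $J$ be a minimal reduction of $I$, that is, an ideal minimal with respect to inclusion among the ideals $J'\subseteq I$ with $I^{n+1}=J'I^n$ for some $n\ge 0$. Write $\lambda$ for length, and let $$r_J^{\mathfrak m}(I)=\min\{n\ge 0 : \mathfrak m I^{n+1}=\mathfrak m J I^n\}.$$ Then there are unique integers $g_0,g_1,g_2$ such that $$\lambda(R/\mathfrak m I^n)=g_0\binom{n+1}{2}-g_1 n+g_2\qquad\text{for all sufficiently large } n,$$ the length $\lambda(\mathfrak m I/\mathfrak m J)$ is finite, and $$r_J^{\mathfrak m}(I)\le g_1+2-\lambda(\mathfrak m I/\mathfrak m J).$$ In particular, if $I$ has almost minimal multiplicity, i.e. $\lambda(\mathfrak m I/\mathfrak m J')=1$ for every minimal reduction $J'$ of $I$, then $r_J^{\mathfrak m}(I)\le g_1+1$. -/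

import Mathlib

/-- The depth of a local ring `R`: the supremum of the lengths of the `R`-regular sequences
contained in the maximal ideal. -/
noncomputable def localDepth (R : Type*) [CommRing R] [IsLocalRing R] : ℕ∞ :=
  ⨆ rs : {rs : List R // (∀ r ∈ rs, r ∈ IsLocalRing.maximalIdeal R) ∧
    RingTheory.Sequence.IsRegular R rs}, (rs.1.length : ℕ∞)

/-- A Cohen-Macaulay local ring: a Noetherian local ring whose depth equals its Krull dimension. -/
structure IsCohenMacaulayLocalRing (R : Type*) [CommRing R] [IsLocalRing R] : Prop where
  isNoetherianRing : IsNoetherianRing R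
  depth_eq_dim : (localDepth R : WithBot ℕ∞) = ringKrullDim R

/-- `I` is primary to the maximal ideal of the local ring `R`. -/
structure IsMaximalIdealPrimary {R : Type*} [CommRing R] [IsLocalRing R] (I : Ideal R) :
    Prop where
  isPrimary : I.IsPrimary
  radical_eq : I.radical = IsLocalRing.maximalIdeal R

/-- `J` is a reduction of `I`: `J ⊆ I` and `I ^ (n + 1) = J I ^ n` for some `n`. -/
def IsReductionOf {R : Type*} [CommRing R] (J I : Ideal R) : Prop :=
  J ≤ I ∧ ∃ n : ℕ, I ^ (n + 1) = J * I ^ n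

/-- `J` is a minimal reduction of `I`: it is minimal, for inclusion, among the reductions
of `I`. -/
def IsMinimalReductionOf {R : Type*} [CommRing R] (J I : Ideal R) : Prop :=
  Minimal (fun J' : Ideal R => IsReductionOf J' I) J

/-- The `K`-reduction number `r_J^K(I) = min {n | K I ^ (n + 1) = K J I ^ n}`. -/
noncomputable def kReductionNumber {R : Type*} [CommRing R] (K J I : Ideal R) : ℕ :=
  sInf {n : ℕ | K * I ^ (n + 1) = K * J * I ^ n}

/-- When `J` is a reduction of `I` the minimum defining the `K`-reduction number is attained. -/
theorem kReductionNumber_isLeast {R : Type*} [CommRing R] (K : Ideal R) {J I : Ideal R}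
    (h : IsReductionOf J I) :
    IsLeast {n : ℕ | K * I ^ (n + 1) = K * J * I ^ n} (kReductionNumber K J I) := by
  obtain ⟨n, hn⟩ := h.2
  have hne : {n : ℕ | K * I ^ (n + 1) = K * J * I ^ n}.Nonempty :=
    ⟨n, show K * I ^ (n + 1) = K * J * I ^ n by rw [hn, mul_assoc]⟩
  exact ⟨Nat.sInf_mem hne, fun m hm => Nat.sInf_le hm⟩

/-- The length of the quotient `A / (A ∩ B)` of ideals; for `B ⊆ A` this is the length
of `A / B`. -/
noncomputable def idealQuotientLength {R : Type*} [CommRing R] (A B : Ideal R) : ℕ∞ :=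
  Module.length R (A ⧸ B.submoduleOf A)

/-- The integers `g 0, …, g d` are the coefficients of the polynomial that agrees for all
large `n` with the Hilbert function `n ↦ length (R / K I ^ n)` of `I` with respect to `K`:
for all large `n` this length is finite and equals
`∑ i, (-1) ^ i * g i * ((n + d - 1 - i).choose (d - i))`. -/
def IsHilbertCoefficients {R : Type*} [CommRing R] (K I : Ideal R) (d : ℕ)
    (g : Fin (d + 1) → ℤ) : Prop :=
  ∀ᶠ n : ℕ in Filter.atTop, ∃ h : ℕ, Module.length R (R ⧸ K * I ^ n) = h ∧
    (h : ℤ) = ∑ i : Fin (d + 1),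
      (-1) ^ (i : ℕ) * g i * ((n + d - 1 - (i : ℕ)).choose (d - (i : ℕ)) : ℤ)

/-- `I` has almost minimal multiplicity with respect to `K`: for every minimal reduction `J`
of `I` the length of `K I / K J` is one. -/
def HasAlmostMinimalMultiplicity {R : Type*} [CommRing R] (K I : Ideal R) : Prop :=
  ∀ J : Ideal R, IsMinimalReductionOf J I → idealQuotientLength (K * I) (K * J) = 1

/-! Replace the filtration `𝔪 I ^ n` by its Ratliff–Rush type closure `F n`: it equals `𝔪 I ^ n` for
large `n`, starts with `F 0 = 𝔪`, and satisfies `F (n + 1) : J = F n`. Since the residue field is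
infinite and the dimension is two, `J` has two generators
(`exists_eq_span_pair_of_isMinimalReductionOf`), and Cohen–Macaulayness leaves them only Koszul
syzygies.

The resulting exact sequence `0 → R/(F : J) → (R/F)² → J/JF → 0` (`two_mul_length_quotient_eq`)
expresses `v n = λ(F (n + 1) / J F n)` through second differences of `n ↦ λ(R / F n)`. The sum
telescopes to `∑ v n = g₁ + 1` (`sum_length_eq_of_ratliffRush`).

As `J F 0 = 𝔪 J ⊆ 𝔪 I ⊆ F 1`, the number `v 0` is `λ(F 1 / 𝔪 I) + λ(𝔪 I / 𝔪 J)`. Hence `F 1 / 𝔪 I`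
and the later quotients `F (n + 1) / J F n` need altogether at most `ν = g₁ + 1 - λ(𝔪 I / 𝔪 J)`
generators. A graded Cayley–Hamilton argument on these generators (`mul_pow_card_eq_of_generators`)
gives `𝔪 I ^ (ν + 2) = 𝔪 J I ^ (ν + 1)`, so the reduction number is at most `ν + 1`. -/

open IsLocalRing

/-! ### Regular pairs and Koszul syzygies. -/

section Depth

theorem exists_regular_pair_of_isCohenMacaulayLocalRing {R : Type*} [CommRing R] [IsLocalRing R]
    (hCM : IsCohenMacaulayLocalRing R) (hdim : ringKrullDim R = 2) :
    ∃ x ∈ maximalIdeal R, ∃ y ∈ maximalIdeal R,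
      (∀ w, x * w = 0 → w = 0) ∧ ∀ w, x ∣ y * w → x ∣ w := by
  have hd : localDepth R = 2 := by
    have h := hCM.depth_eq_dim.trans hdim
    exact WithBot.coe_injective h
  have : ∃ rs : List R, (∀ r ∈ rs, r ∈ maximalIdeal R) ∧
      RingTheory.Sequence.IsRegular R rs ∧ 2 ≤ rs.length := by
    by_contra! hcon
    have : localDepth R ≤ 1 := by
      refine iSup_le fun rs => ?_
      have := hcon rs.1 rs.2.1 rs.2.2
      exact_mod_cast Nat.lt_succ_iff.mp this
    rw [hd] at this
    exact absurd this (by decide)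
  obtain ⟨rs, hm, hreg, hlen⟩ := this
  match rs, hm, hreg, hlen with
  | x :: y :: t, hm, hreg, _ =>
    have hw := hreg.toIsWeaklyRegular
    rw [RingTheory.Sequence.isWeaklyRegular_cons_iff,
      RingTheory.Sequence.isWeaklyRegular_cons_iff] at hw
    refine ⟨x, hm x (by simp), y, hm y (by simp), fun w hxw => ?_, fun w hw' => ?_⟩
    · exact hw.1.right_eq_zero_of_smul hxw
    · have h2 := hw.2.1
      have key : ∀ v : R, (Submodule.Quotient.mk v : QuotSMulTop x R) = 0 ↔ x ∣ v := by
        intro v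
        rw [Submodule.Quotient.mk_eq_zero, Submodule.mem_smul_pointwise_iff_exists]
        constructor
        · rintro ⟨b, -, rfl⟩; exact ⟨b, rfl⟩
        · rintro ⟨b, rfl⟩; exact ⟨b, trivial, rfl⟩
      rw [← key] at hw' ⊢
      exact h2.right_eq_zero_of_smul hw'

variable {R : Type*} [CommRing R] {x y : R}

theorem pow_mul_left_injective_at_zero (hx : ∀ w, x * w = 0 → w = 0) (n : ℕ) (w : R)
    (h : x ^ n * w = 0) : w = 0 := by
  induction n with
  | zero => simpa using h
  | succ n ih => exact ih (hx _ (by rw [← h]; ring))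

/-- Regularity of `y` modulo `x` lifts to `x ^ n` by peeling off one factor `x` at a time and
cancelling it. -/
theorem pow_dvd_of_pow_dvd_pow_mul (hx : ∀ w, x * w = 0 → w = 0)
    (hy : ∀ w, x ∣ y * w → x ∣ w) (n m : ℕ) (w : R) (h : x ^ n ∣ y ^ m * w) : x ^ n ∣ w := by
  have step : ∀ n w, x ^ n ∣ y * w → x ^ n ∣ w := by
    intro n
    induction n with
    | zero => simp
    | succ n ih =>
      rintro w ⟨s, hs⟩
      obtain ⟨v, rfl⟩ := hy w ⟨x ^ n * s, by rw [hs]; ring⟩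
      have : y * v = x ^ n * s := sub_eq_zero.mp (hx _ (by linear_combination hs))
      obtain ⟨t, rfl⟩ := ih v ⟨s, this⟩
      exact ⟨t, by ring⟩
  induction m with
  | zero => simpa using h
  | succ m ih => exact ih (step n _ (by rwa [← mul_assoc, ← pow_succ']))

/-- Two elements whose ideal contains powers of a regular pair have only Koszul syzygies. -/
theorem exists_koszul_of_mul_add_mul_eq_zero (hx : ∀ w, x * w = 0 → w = 0)
    (hy : ∀ w, x ∣ y * w → x ∣ w) {a b : R} {n : ℕ} (hxn : x ^ n ∈ Ideal.span {a, b})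
    (hyn : y ^ n ∈ Ideal.span {a, b}) {u v : R} (huv : u * a + v * b = 0) :
    ∃ w, u = w * b ∧ v = -(w * a) := by
  obtain ⟨p, q, hpq⟩ := Ideal.mem_span_pair.mp hxn
  obtain ⟨r, s, hrs⟩ := Ideal.mem_span_pair.mp hyn
  have h1 : x ^ n * u = (q * u - p * v) * b := by
    rw [← hpq]; linear_combination p * huv
  have h2 : x ^ n * v = -((q * u - p * v) * a) := by
    rw [← hpq]; linear_combination q * huv
  -- `h1` and `h2` give `y ^ n * (q u - p v) = x ^ n * (s u - r v)`, and `y ^ n` is regular modulo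
  -- `x ^ n`.
  obtain ⟨c, hc⟩ : x ^ n ∣ q * u - p * v := by
    refine pow_dvd_of_pow_dvd_pow_mul hx hy n n _ ⟨s * u - r * v, ?_⟩
    rw [← hrs]; linear_combination -s * h1 + r * h2
  refine ⟨c, sub_eq_zero.mp (pow_mul_left_injective_at_zero hx n _ ?_),
    sub_eq_zero.mp (pow_mul_left_injective_at_zero hx n _ ?_)⟩
  · rw [hc] at h1; linear_combination h1
  · rw [hc] at h2; linear_combination h2

end Depth

/-! ### Colon ideals and the Ratliff–Rush type closure. -/

section Colon

variable {R : Type*} [CommRing R] [IsNoetherianRing R]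

/-- A stable filtration by ideals satisfies `L (n + 1) : J = L n` for large `n`, when `J` contains
a regular element. -/
theorem exists_forall_colon_le_of_stable {J : Ideal R} {x : R} (hxJ : x ∈ J)
    (hx : ∀ w, x * w = 0 → w = 0) (L : J.Filtration R) (hL : L.Stable) :
    ∃ n₀, ∀ n ≥ n₀, (L.N (n + 1)).colon (J : Set R) ≤ L.N n := by
  -- Multiplication by `x` moves the colons `L n : J` inside `L n`, so Artin–Rees makes `C` stable.
  -- Then `x (L (n + 1) : J) = J x (L n : J) ⊆ x L n` for large `n`, and `x` cancels.
  let C : J.Filtration R :=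
    { N := fun n => Submodule.map (LinearMap.mulLeft R x) ((L.N n).colon (J : Set R))
      mono := fun n => Submodule.map_mono (Submodule.colon_mono (L.mono n) subset_rfl)
      smul_le := fun n => by
        rw [Submodule.smul_le]
        rintro j hj _ ⟨w, hw, rfl⟩
        refine ⟨j * w, ?_, by simp only [LinearMap.mulLeft_apply, smul_eq_mul]; ring⟩
        have hw' := Submodule.mem_colon.mp hw j hj
        refine Submodule.mem_colon.mpr fun i hi => ?_
        have := L.smul_le n (Submodule.smul_mem_smul hi hw')
        simp only [smul_eq_mul] at this ⊢
        convert this using 1; ring }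
  have hCL : C ≤ L := by
    rintro n _ ⟨w, hw, rfl⟩
    have := Submodule.mem_colon.mp hw x hxJ
    simp only [smul_eq_mul, LinearMap.mulLeft_apply] at this ⊢
    rwa [mul_comm]
  obtain ⟨n₀, hn₀⟩ := Ideal.Filtration.Stable.of_le hL hCL
  refine ⟨n₀, fun n hn w hw => ?_⟩
  have h1 : x * w ∈ C.N (n + 1) := ⟨w, hw, rfl⟩
  rw [← hn₀ n hn] at h1
  have h2 : J • C.N n ≤ Submodule.map (LinearMap.mulLeft R x) (L.N n) := by
    rw [Submodule.smul_le]
    rintro j hj _ ⟨v, hv, rfl⟩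
    have hv' := Submodule.mem_colon.mp hv j hj
    refine ⟨v * j, hv', by simp only [LinearMap.mulLeft_apply, smul_eq_mul]; ring⟩
  obtain ⟨v, hv, hvw⟩ := h2 h1
  have : v = w := sub_eq_zero.mp (hx _ (by
    simp only [LinearMap.mulLeft_apply] at hvw; linear_combination hvw))
  exact this ▸ hv

variable [IsLocalRing R]

/-- The Ratliff-Rush type closure of the filtration `n ↦ 𝔪 I ^ n`. -/
theorem exists_ratliffRush_filtration {I J : Ideal R} (hJI : IsReductionOf J I)
    {x : R} (hxJ : x ∈ J) (hx : ∀ w, x * w = 0 → w = 0) :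
    ∃ (F : ℕ → Ideal R) (n₀ : ℕ), F 0 = maximalIdeal R ∧ (∀ n, maximalIdeal R * I ^ n ≤ F n) ∧
      (∀ n ≥ n₀, F n = maximalIdeal R * I ^ n) ∧ (∀ n ≥ n₀, F (n + 1) = J * F n) ∧
      (∀ n, I * F n ≤ F (n + 1)) ∧ ∀ n, (F (n + 1)).colon (J : Set R) = F n := by
  obtain ⟨hle, r, hr⟩ := hJI
  have hpow : ∀ k, I ^ (r + k) = J ^ k * I ^ r := by
    intro k
    induction k with
    | zero => simp
    | succ k ih =>
      rw [← add_assoc, pow_succ, ih, mul_assoc, ← pow_succ, hr]; ring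
  let L : J.Filtration R :=
    { N := fun n => maximalIdeal R * I ^ n
      mono := fun n => Ideal.mul_mono_right (Ideal.pow_le_pow_right (Nat.le_succ n))
      smul_le := fun n => by
        calc J * (maximalIdeal R * I ^ n) ≤ I * (maximalIdeal R * I ^ n) := Ideal.mul_mono_left hle
          _ = maximalIdeal R * I ^ (n + 1) := by ring }
  have hst : ∀ n ≥ r, J * (maximalIdeal R * I ^ n) = maximalIdeal R * I ^ (n + 1) := by
    intro n hn
    obtain ⟨k, rfl⟩ := Nat.exists_eq_add_of_le hn
    rw [add_assoc, hpow, hpow]; ring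
  obtain ⟨n₁, hn₁⟩ := exists_forall_colon_le_of_stable hxJ hx L ⟨r, hst⟩
  have hcol : ∀ n ≥ n₁, ∀ k, (maximalIdeal R * I ^ (n + k)).colon ((J ^ k : Ideal R) : Set R)
      ≤ maximalIdeal R * I ^ n := by
    intro n hn k
    induction k with
    | zero =>
      intro w hw
      simpa using Submodule.mem_colon.mp hw 1 (by simp)
    | succ k ih =>
      intro w hw
      refine ih (Submodule.mem_colon.mpr fun s hs => hn₁ (n + k) (by omega) ?_)
      refine Submodule.mem_colon.mpr fun j hj => ?_
      have := Submodule.mem_colon.mp hw (s * j) (by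
        rw [SetLike.mem_coe, pow_succ]; exact Ideal.mul_mem_mul hs hj)
      change w * s * j ∈ maximalIdeal R * I ^ (n + k + 1)
      rwa [smul_eq_mul, ← mul_assoc] at this
  have hLF : ∀ n k, maximalIdeal R * I ^ n ≤
      (maximalIdeal R * I ^ (n + k)).colon ((J ^ k : Ideal R) : Set R) := by
    intro n k w hw
    refine Submodule.mem_colon.mpr fun s hs => ?_
    rw [pow_add, ← mul_assoc]
    exact Ideal.mul_mem_mul hw (Ideal.pow_right_mono hle k hs)
  -- Shifting by `n₁` puts every index where colons by `J` have stabilised, so one exponent serves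
  -- all `n`.
  set F : ℕ → Ideal R := fun n =>
    (maximalIdeal R * I ^ (n + n₁)).colon ((J ^ n₁ : Ideal R) : Set R) with hF
  have hFL : ∀ n ≥ n₁, F n = maximalIdeal R * I ^ n := fun n hn =>
    le_antisymm (hcol n hn n₁) (hLF n n₁)
  refine ⟨F, max n₁ r, ?_, fun n => hLF n n₁, fun n hn => hFL n (by omega), fun n hn => ?_,
    fun n => ?_, fun n => le_antisymm ?_ ?_⟩
  · refine ((maximalIdeal.isMaximal R).eq_of_le ?_ ?_).symm
    -- If `F 0` were the unit ideal, then `J ^ n₁ ⊆ 𝔪 I ^ n₁`; multiplying by `I ^ r` and applying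
    -- Nakayama kills a power of `I`, though `I` contains the regular element `x`.
    · intro htop
      have h1 : (1 : R) ∈ F 0 := by rw [htop]; trivial
      have h2 : J ^ n₁ ≤ maximalIdeal R * I ^ n₁ := fun s hs => by
        simpa using Submodule.mem_colon.mp h1 s hs
      have h3 : I ^ (r + n₁) = ⊥ := by
        refine Submodule.eq_bot_of_le_smul_of_le_jacobson_bot (maximalIdeal R) _
          (IsNoetherian.noetherian _) ?_ (by rw [IsLocalRing.jacobson_eq_maximalIdeal _ bot_ne_top])
        calc I ^ (r + n₁) = J ^ n₁ * I ^ r := hpow n₁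
          _ ≤ maximalIdeal R * I ^ n₁ * I ^ r := Ideal.mul_mono_left h2
          _ = maximalIdeal R * I ^ (r + n₁) := by ring
      have h4 : x ^ (r + n₁) = 0 := by
        have := Ideal.pow_mem_pow (hle hxJ) (r + n₁)
        rwa [h3, Ideal.mem_bot] at this
      exact one_ne_zero (pow_mul_left_injective_at_zero hx (r + n₁) (1 : R) (by rw [h4, zero_mul]))
    · have := hLF 0 n₁
      rwa [pow_zero, mul_one] at this
  · rw [hFL n (by omega), hFL (n + 1) (by omega), hst n (by omega)]
  · rw [Ideal.mul_le]
    intro i hi w hw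
    refine Submodule.mem_colon.mpr fun s hs => ?_
    have := Ideal.mul_mem_mul hi (Submodule.mem_colon.mp hw s hs)
    have e : I * (maximalIdeal R * I ^ (n + n₁)) = maximalIdeal R * I ^ (n + 1 + n₁) := by ring
    rw [e] at this
    simpa [mul_assoc] using this
  · intro w hw
    refine Submodule.mem_colon.mpr fun s hs => hn₁ _ (by omega) ?_
    refine Submodule.mem_colon.mpr fun j hj => ?_
    have := Submodule.mem_colon.mp (Submodule.mem_colon.mp hw j hj) s hs
    have e : n + n₁ + 1 = n + 1 + n₁ := by ring
    change w * s * j ∈ maximalIdeal R * I ^ (n + n₁ + 1)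
    rw [e]
    simpa [mul_assoc, mul_comm, mul_left_comm] using this
  · intro w hw
    refine Submodule.mem_colon.mpr fun j hj => Submodule.mem_colon.mpr fun s hs => ?_
    have := Ideal.mul_mem_mul (hle hj) (Submodule.mem_colon.mp hw s hs)
    have e : I * (maximalIdeal R * I ^ (n + n₁)) = maximalIdeal R * I ^ (n + 1 + n₁) := by ring
    rw [e] at this
    simpa [mul_assoc, mul_comm, mul_left_comm] using this

end Colon

/-! ### Lengths of quotients of ideals. -/

section Length

variable {R : Type*} [CommRing R]

theorem length_quotient_eq_add {A B : Ideal R} (h : B ≤ A) :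
    Module.length R (R ⧸ B) = idealQuotientLength A B + Module.length R (R ⧸ A) := by
  refine Module.length_eq_add_of_exact
    (Submodule.mapQ (B.submoduleOf A) B A.subtype le_rfl) (Submodule.factor h) ?_ ?_ ?_
  · rw [← LinearMap.ker_eq_bot]
    exact Submodule.ker_liftQ_eq_bot _ _ _ (by
      intro w hw
      exact (Submodule.Quotient.mk_eq_zero B).mp hw)
  · exact Submodule.factor_surjective h
  · rintro ⟨w⟩
    constructor
    · intro hw
      have hw' : w ∈ A := by
        rw [← Submodule.Quotient.mk_eq_zero]; exact hw
      exact ⟨Submodule.Quotient.mk ⟨w, hw'⟩, rfl⟩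
    · rintro ⟨⟨v⟩, hv⟩
      rw [← hv]
      exact (Submodule.Quotient.mk_eq_zero A).mpr v.2

theorem idealQuotientLength_add {A B C : Ideal R} (hAB : B ≤ A) (hBC : C ≤ B)
    (hC : Module.length R (R ⧸ C) ≠ ⊤) :
    idealQuotientLength A C = idealQuotientLength A B + idealQuotientLength B C := by
  have h1 := length_quotient_eq_add hAB
  have h2 := length_quotient_eq_add hBC
  have h3 := length_quotient_eq_add (hBC.trans hAB)
  rw [h2, h1] at h3
  have hA : Module.length R (R ⧸ A) ≠ ⊤ := by
    intro h; apply hC; rw [h2, h1, h]; simp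
  rw [← add_assoc] at h3
  rw [add_comm (idealQuotientLength A B)]
  exact (ENat.add_left_injective_of_ne_top hA h3).symm

theorem length_quotient_ne_top_of_le {A B : Ideal R} (h : B ≤ A)
    (hB : Module.length R (R ⧸ B) ≠ ⊤) : Module.length R (R ⧸ A) ≠ ⊤ := by
  intro hA; apply hB; rw [length_quotient_eq_add h, hA]; simp

theorem idealQuotientLength_ne_top {A B : Ideal R} (h : B ≤ A)
    (hB : Module.length R (R ⧸ B) ≠ ⊤) : idealQuotientLength A B ≠ ⊤ := by
  intro hA; apply hB; rw [length_quotient_eq_add h, hA]; simp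

theorem length_quotient_ne_top [IsNoetherianRing R] [IsLocalRing R] {A : Ideal R}
    (hA : maximalIdeal R ≤ A.radical) : Module.length R (R ⧸ A) ≠ ⊤ := by
  have : IsArtinianRing (R ⧸ A) := by
    have : Ring.KrullDimLE 0 (R ⧸ A) := by
      refine Ring.krullDimLE_zero_iff.mpr fun P hP => ?_
      have h1 : A ≤ P.comap (Ideal.Quotient.mk A) := fun w hw => by
        rw [Ideal.mem_comap, Ideal.Quotient.eq_zero_iff_mem.mpr hw]; exact P.zero_mem
      have h2 : maximalIdeal R = P.comap (Ideal.Quotient.mk A) := by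
        refine (maximalIdeal.isMaximal R).eq_of_le (Ideal.IsPrime.ne_top inferInstance) ?_
        exact hA.trans ((Ideal.IsPrime.radical_le_iff inferInstance).mpr h1)
      refine Ideal.isMaximal_of_isIntegral_of_isMaximal_comap (R := R) _ ?_
      exact h2 ▸ maximalIdeal.isMaximal R
    exact IsNoetherianRing.isArtinianRing_of_krullDimLE_zero
  rw [Module.length_eq_of_surjective (R := R ⧸ A) (S := R) (M := R ⧸ A)
    Ideal.Quotient.mk_surjective]
  exact Module.length_ne_top

/-- Length count in `0 → R/(F : J) → (R/F)² → J/JF → 0` with maps `w ↦ (w b, -w a)` and `(u, v) ↦ u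
a + v b`. Middle exactness: correct `(u, v)` by a pair from `F` to get a true syzygy, which is
Koszul. -/
theorem two_mul_length_quotient_eq {a b : R} {F : Ideal R}
    (hkos : ∀ u v : R, u * a + v * b = 0 → ∃ w, u = w * b ∧ v = -(w * a)) :
    Module.length R (R ⧸ F) + Module.length R (R ⧸ F) =
      Module.length R (R ⧸ F.colon (Ideal.span {a, b} : Set R)) +
        idealQuotientLength (Ideal.span {a, b}) (Ideal.span {a, b} * F) := by
  set J := Ideal.span {a, b} with hJ
  have ha : a ∈ J := Ideal.subset_span (by simp)
  have hb : b ∈ J := Ideal.subset_span (by simp)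
  have hcol : ∀ w, w ∈ F.colon (J : Set R) ↔ w * b ∈ F ∧ w * a ∈ F := by
    intro w
    rw [Submodule.mem_colon]
    refine ⟨fun h => ⟨h b hb, h a ha⟩, fun h s hs => ?_⟩
    obtain ⟨p, q, rfl⟩ := Ideal.mem_span_pair.mp hs
    have : w • (p * a + q * b) = p * (w * a) + q * (w * b) := by simp only [smul_eq_mul]; ring
    rw [this]
    exact F.add_mem (F.mul_mem_left _ h.2) (F.mul_mem_left _ h.1)
  rw [← Module.length_prod]
  let ψ : R →ₗ[R] (R ⧸ F) × (R ⧸ F) :=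
    (F.mkQ.comp (LinearMap.mulRight R b)).prod (-(F.mkQ.comp (LinearMap.mulRight R a)))
  have hψ : LinearMap.ker ψ = F.colon (J : Set R) := by
    ext w
    rw [hcol]
    rw [← Ideal.Quotient.eq_zero_iff_mem (a := w * b), ← Ideal.Quotient.eq_zero_iff_mem (a := w * a)]
    simp [ψ, LinearMap.mem_ker]
  let ea : R →ₗ[R] J := LinearMap.toSpanSingleton R J ⟨a, ha⟩
  let eb : R →ₗ[R] J := LinearMap.toSpanSingleton R J ⟨b, hb⟩
  have hea : F ≤ ((J * F).submoduleOf J).comap ea := fun w hw => by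
    change w * a ∈ J * F
    rw [mul_comm w a]; exact Ideal.mul_mem_mul ha hw
  have heb : F ≤ ((J * F).submoduleOf J).comap eb := fun w hw => by
    change w * b ∈ J * F
    rw [mul_comm w b]; exact Ideal.mul_mem_mul hb hw
  let φ : (R ⧸ F) × (R ⧸ F) →ₗ[R] J ⧸ (J * F).submoduleOf J :=
    (Submodule.mapQ _ _ ea hea).coprod (Submodule.mapQ _ _ eb heb)
  have hφ : ∀ u v : R, φ (Submodule.Quotient.mk u, Submodule.Quotient.mk v) =
      Submodule.Quotient.mk ⟨u * a + v * b, J.add_mem (J.mul_mem_left _ ha)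
        (J.mul_mem_left _ hb)⟩ := by
    intro u v; rfl
  refine Module.length_eq_add_of_exact (Submodule.liftQ _ ψ hψ.ge) φ ?_ ?_ ?_
  · rw [← LinearMap.ker_eq_bot]
    exact Submodule.ker_liftQ_eq_bot _ _ _ hψ.le
  · rintro ⟨⟨w, hw⟩⟩
    obtain ⟨p, q, rfl⟩ := Ideal.mem_span_pair.mp hw
    exact ⟨(Submodule.Quotient.mk p, Submodule.Quotient.mk q), hφ p q⟩
  · rintro ⟨⟨u⟩, ⟨v⟩⟩
    constructor
    · intro h
      have h1 : u * a + v * b ∈ J * F := by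
        have h' := (hφ u v).symm.trans h
        rw [Submodule.Quotient.mk_eq_zero] at h'
        exact h'
      have h2 : ∃ f ∈ F, ∃ g ∈ F, u * a + v * b = f * a + g * b := by
        have : J * F ≤ Submodule.map (LinearMap.mulRight R a) F ⊔
            Submodule.map (LinearMap.mulRight R b) F := by
          rw [Ideal.mul_le]
          intro r hr s hs
          obtain ⟨p, q, rfl⟩ := Ideal.mem_span_pair.mp hr
          refine Submodule.mem_sup.mpr ⟨_, ⟨p * s, F.mul_mem_left _ hs, rfl⟩, _,
            ⟨q * s, F.mul_mem_left _ hs, rfl⟩, ?_⟩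
          simp only [LinearMap.mulRight_apply]; ring
        obtain ⟨_, ⟨f, hf, rfl⟩, _, ⟨g, hg, rfl⟩, h⟩ := Submodule.mem_sup.mp (this h1)
        exact ⟨f, hf, g, hg, h.symm⟩
      obtain ⟨f, hf, g, hg, hfg⟩ := h2
      obtain ⟨w, hw1, hw2⟩ := hkos (u - f) (v - g) (by linear_combination hfg)
      refine ⟨Submodule.Quotient.mk w, Prod.ext ?_ ?_⟩
      · change (Submodule.Quotient.mk (w * b) : R ⧸ F) = Submodule.Quotient.mk u
        rw [Submodule.Quotient.eq, ← hw1]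
        simpa using F.neg_mem hf
      · change -(Submodule.Quotient.mk (w * a) : R ⧸ F) = Submodule.Quotient.mk v
        rw [← Submodule.Quotient.mk_neg, Submodule.Quotient.eq, ← hw2]
        simpa using F.neg_mem hg
    · rintro ⟨⟨w⟩, hw⟩
      rw [← hw]
      change φ (Submodule.Quotient.mk (w * b), -Submodule.Quotient.mk (w * a)) = 0
      rw [← Submodule.Quotient.mk_neg, hφ, Submodule.Quotient.mk_eq_zero]
      change w * b * a + -(w * a) * b ∈ J * F
      convert (J * F).zero_mem using 1
      ring

theorem idealQuotientLength_ne_zero {A B : Ideal R} (h : ¬ A ≤ B) :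
    idealQuotientLength A B ≠ 0 := by
  rw [idealQuotientLength, Ne, Module.length_eq_zero_iff]
  refine fun h' => h fun w hw => ?_
  have h1 : (Submodule.Quotient.mk ⟨w, hw⟩ : A ⧸ B.submoduleOf A) = 0 := Subsingleton.elim _ _
  have h2 := (Submodule.Quotient.mk_eq_zero _).mp h1
  exact h2

/-- The quotient of ideals `A / B` is generated by at most as many elements as its length. -/
theorem exists_generators_of_idealQuotientLength_eq (l : ℕ) {A B : Ideal R} (hBA : B ≤ A)
    (hB : Module.length R (R ⧸ B) ≠ ⊤) (hl : idealQuotientLength A B = l) :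
    ∃ m : Fin l → R, (∀ i, m i ∈ A) ∧ ∀ w ∈ A, ∃ c : Fin l → R, w - ∑ i, c i * m i ∈ B := by
  induction l using Nat.strong_induction_on generalizing B with
  | _ l ih =>
    by_cases hAB : A ≤ B
    · exact ⟨0, fun _ => A.zero_mem, fun w hw => ⟨0, by simpa using hAB hw⟩⟩
    · obtain ⟨b, hbA, hbB⟩ := SetLike.not_le_iff_exists.mp hAB
      set B' := B ⊔ Ideal.span {b} with hB'
      have hBB' : B ≤ B' := le_sup_left
      have hB'A : B' ≤ A := sup_le hBA (by rwa [Ideal.span_singleton_le_iff_mem])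
      have hadd := idealQuotientLength_add hB'A hBB' hB
      have hne : idealQuotientLength B' B ≠ 0 := idealQuotientLength_ne_zero fun h =>
        hbB (h (le_sup_right (a := B) (Ideal.mem_span_singleton_self b)))
      have hB'top := length_quotient_ne_top_of_le hBB' hB
      obtain ⟨k, hk⟩ := ENat.ne_top_iff_exists.mp (idealQuotientLength_ne_top hB'A hB'top)
      obtain ⟨j, hj⟩ := ENat.ne_top_iff_exists.mp (idealQuotientLength_ne_top hBB' hB)
      rw [hl, ← hk, ← hj] at hadd
      rw [← hj] at hne
      have hlkj : l = k + j := by exact_mod_cast hadd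
      have hj0 : j ≠ 0 := by exact_mod_cast hne
      obtain ⟨m, hm, hgen⟩ := ih k (by omega) hB'A hB'top hk.symm
      -- The one element `b` accounts for length `j ≥ 1`; the `e = j - 1` spare places are filled
      -- with zeros so that the family has exactly `l` members.
      obtain ⟨e, rfl⟩ : ∃ e, l = k + (1 + e) := ⟨j - 1, by omega⟩
      refine ⟨Fin.append m (Fin.append (fun _ => b) 0), fun i => ?_, fun w hw => ?_⟩
      · refine Fin.addCases (fun i => ?_) (fun i => ?_) i
        · simpa using hm i
        · refine Fin.addCases (fun i => ?_) (fun i => ?_) i <;> simp [hbA]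
      · obtain ⟨c, hc⟩ := hgen w hw
        obtain ⟨y, hy, z, hz, hyz⟩ := Submodule.mem_sup.mp hc
        obtain ⟨t, rfl⟩ := Ideal.mem_span_singleton'.mp hz
        refine ⟨Fin.append c (Fin.append (fun _ => t) 0), ?_⟩
        simp only [Fin.sum_univ_add, Fin.append_left, Fin.append_right]
        simpa [← sub_sub, ← hyz] using hy

theorem idealQuotientLength_span_le {ι : Type*} [Fintype ι] (f : ι → R) (q : Ideal R) :
    idealQuotientLength (Ideal.span (Set.range f)) (q * Ideal.span (Set.range f)) ≤
      Fintype.card ι * Module.length R (R ⧸ q) := by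
  set A := Ideal.span (Set.range f) with hA
  have hf : ∀ i, f i ∈ A := fun i => Ideal.subset_span ⟨i, rfl⟩
  let e : ι → (R →ₗ[R] A) := fun i => LinearMap.toSpanSingleton R A ⟨f i, hf i⟩
  have he : ∀ i, q ≤ ((q * A).submoduleOf A).comap (e i) := fun i w hw => by
    change w * f i ∈ q * A
    exact Ideal.mul_mem_mul hw (hf i)
  let g : (ι → R ⧸ q) →ₗ[R] A ⧸ (q * A).submoduleOf A :=
    ∑ i, (Submodule.mapQ _ _ (e i) (he i)).comp (LinearMap.proj i)
  have hg : Function.Surjective g := by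
    rintro ⟨⟨w, hw⟩⟩
    obtain ⟨c, hc⟩ := (Ideal.mem_span_range_iff_exists_fun).mp hw
    refine ⟨fun i => Submodule.Quotient.mk (c i), ?_⟩
    simp only [g, LinearMap.sum_apply, LinearMap.comp_apply, LinearMap.proj_apply,
      Submodule.mapQ_apply]
    simp only [← Submodule.mkQ_apply, ← map_sum]
    change Submodule.mkQ _ _ = Submodule.mkQ _ (⟨w, hw⟩ : A)
    congr 1
    apply Subtype.ext
    simp [e, ← hc]
  refine (Module.length_le_of_surjective g hg).trans ?_
  rw [Module.length_pi]; simp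

/-- The span of the `f i` in `A / 𝔪 A` surjects onto `k ^ ι`, where `k` is the residue field. This
turns analytic independence into lower bounds on lengths. -/
theorem card_le_idealQuotientLength [IsLocalRing R] {ι : Type*} [Fintype ι] {A : Ideal R}
    (f : ι → R) (hf : ∀ i, f i ∈ A)
    (hind : ∀ c : ι → R, ∑ i, c i * f i ∈ maximalIdeal R * A → ∀ i, c i ∈ maximalIdeal R) :
    (Fintype.card ι : ℕ∞) ≤ idealQuotientLength A (maximalIdeal R * A) := by
  let g : (ι → R) →ₗ[R] A ⧸ (maximalIdeal R * A).submoduleOf A :=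
    (Submodule.mkQ _).comp (Fintype.linearCombination R (fun i => (⟨f i, hf i⟩ : A)))
  let p : (ι → R) →ₗ[R] (ι → ResidueField R) :=
    LinearMap.pi fun i => (Algebra.linearMap R (ResidueField R)).comp (LinearMap.proj i)
  have hp : Function.Surjective p := by
    intro c
    choose d hd using fun i => IsLocalRing.residue_surjective (c i)
    exact ⟨d, funext hd⟩
  have hker : LinearMap.ker g ≤ LinearMap.ker p := by
    intro c hc
    have h1 : ∑ i, c i * f i ∈ maximalIdeal R * A := by
      have h2 : Submodule.mkQ _ _ = 0 := hc
      rw [Submodule.mkQ_apply, Submodule.Quotient.mk_eq_zero] at h2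
      have h3 : ((Fintype.linearCombination R (fun i => (⟨f i, hf i⟩ : A)) c : A) : R) ∈
        maximalIdeal R * A := h2
      simpa [Fintype.linearCombination_apply] using h3
    refine LinearMap.mem_ker.mpr (funext fun i => ?_)
    exact (IsLocalRing.residue_eq_zero_iff _).mpr (hind c h1 i)
  have e1 : Module.length R (ι → ResidueField R) = Fintype.card ι := by
    rw [Module.length_pi]
    have : Module.length R (ResidueField R) = 1 := by
      rw [Module.length_eq_of_surjective (R := ResidueField R) (S := R)
        IsLocalRing.residue_surjective, Module.length_eq_one_iff]
      infer_instance
    rw [this]; simp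
  rw [← e1]
  refine (Module.length_le_of_surjective (Submodule.liftQ _ p hker) ?_).trans
    (Module.length_le_of_injective (Submodule.liftQ _ g le_rfl) ?_)
  · intro c
    obtain ⟨d, hd⟩ := hp c
    exact ⟨Submodule.Quotient.mk d, hd⟩
  · rw [← LinearMap.ker_eq_bot]
    exact Submodule.ker_liftQ_eq_bot _ _ _ le_rfl

end Length

/-! ### Substitution into homogeneous forms; transitivity of reductions. -/

section Substitution

variable {R ι : Type*} [CommRing R]

theorem multiset_prod_sub_mem {P Q : Ideal R} {y c : ι → R} {z : R} (hy : ∀ i, y i ∈ Q)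
    (hz : z ∈ Q) (hyc : ∀ i, y i - c i * z ∈ P) (S : Multiset ι) :
    (S.map y).prod - (S.map c).prod * z ^ S.card ∈ P * Q ^ (S.card - 1) := by
  have hmem : ∀ S : Multiset ι, (S.map y).prod ∈ Q ^ S.card := by
    intro S
    induction S using Multiset.induction with
    | empty => simp
    | cons a S ih =>
      rw [Multiset.map_cons, Multiset.prod_cons, Multiset.card_cons, pow_succ']
      exact Ideal.mul_mem_mul (hy a) ih
  induction S using Multiset.induction with
  | empty => simp
  | cons a S ih =>
    simp only [Multiset.map_cons, Multiset.prod_cons, Multiset.card_cons, Nat.add_sub_cancel]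
    have e : y a * (S.map y).prod - c a * (S.map c).prod * z ^ (S.card + 1) =
        (y a - c a * z) * (S.map y).prod +
          c a * (z * ((S.map y).prod - (S.map c).prod * z ^ S.card)) := by ring
    rw [e]
    refine Ideal.add_mem _ (Ideal.mul_mem_mul (hyc a) (hmem S)) (Ideal.mul_mem_left _ _ ?_)
    rcases Nat.eq_zero_or_pos S.card with h | h
    · rw [Multiset.card_eq_zero] at h
      simp [h]
    · obtain ⟨k, hk⟩ := Nat.exists_eq_add_of_lt h
      rw [zero_add] at hk
      have := Ideal.mul_mem_mul hz ih
      rw [hk] at this ⊢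
      rw [Nat.add_sub_cancel] at this
      rwa [pow_succ', mul_left_comm]

/-- Modulo `P` each `y i` is `c i * z`, and a form of degree `n + 1` pulls out `z ^ (n + 1)`; the
error keeps `n` factors in `Q`. The degenerate choices `P = ⊥` and `z = 0` are also used below. -/
theorem eval_sub_eval_mul_pow_mem {P Q : Ideal R} {y c : ι → R} {z : R} (hy : ∀ i, y i ∈ Q)
    (hz : z ∈ Q) (hyc : ∀ i, y i - c i * z ∈ P) {f : MvPolynomial ι R} {n : ℕ}
    (hf : f.IsHomogeneous (n + 1)) :
    MvPolynomial.eval y f - MvPolynomial.eval c f * z ^ (n + 1) ∈ P * Q ^ n := by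
  rw [MvPolynomial.eval_eq, MvPolynomial.eval_eq, Finset.sum_mul, ← Finset.sum_sub_distrib]
  refine Ideal.sum_mem _ fun d hd => ?_
  have hdeg : d.degree = n + 1 := by
    have := hf (MvPolynomial.mem_support_iff.mp hd)
    rwa [Finsupp.degree_eq_weight_one]
  have hcard : d.toMultiset.card = n + 1 := by
    rw [Finsupp.card_toMultiset, ← hdeg]; rfl
  have hprod : ∀ v : ι → R, ∏ i ∈ d.support, v i ^ d i = (d.toMultiset.map v).prod := by
    classical
    intro v
    rw [Finset.prod_multiset_map_count, Finsupp.toFinset_toMultiset]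
    simp
  have := multiset_prod_sub_mem hy hz hyc d.toMultiset
  rw [hcard, Nat.add_sub_cancel] at this
  rw [hprod, hprod, mul_assoc, ← mul_sub]
  exact Ideal.mul_mem_left _ _ this

theorem sup_span_singleton_pow_le (P : Ideal R) (z : R) (n : ℕ) :
    (P ⊔ Ideal.span {z}) ^ (n + 1) ≤ P * (P ⊔ Ideal.span {z}) ^ n ⊔ Ideal.span {z ^ (n + 1)} := by
  induction n with
  | zero => simp
  | succ n ih =>
    set Q := P ⊔ Ideal.span {z} with hQ
    have hzQ : z ∈ Q := le_sup_right (a := P) (Ideal.mem_span_singleton_self z)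
    calc Q ^ (n + 1 + 1) = Q * Q ^ (n + 1) := pow_succ' _ _
      _ ≤ Q * (P * Q ^ n ⊔ Ideal.span {z ^ (n + 1)}) := Ideal.mul_mono_right ih
      _ = P * Q ^ (n + 1) ⊔ (P * Ideal.span {z ^ (n + 1)} ⊔ Ideal.span {z ^ (n + 1 + 1)}) := by
        rw [Ideal.mul_sup]
        congr 1
        · ring
        · rw [hQ, Ideal.sup_mul, Ideal.span_singleton_mul_span_singleton, ← pow_succ']
      _ ≤ P * Q ^ (n + 1) ⊔ Ideal.span {z ^ (n + 1 + 1)} := by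
        refine sup_le le_sup_left (sup_le (le_sup_of_le_left (Ideal.mul_mono_right ?_)) le_sup_right)
        rw [Ideal.span_singleton_le_iff_mem]
        exact Ideal.pow_mem_pow hzQ _

theorem IsReductionOf.trans {A B C : Ideal R} (hAB : IsReductionOf A B) (hBC : IsReductionOf B C) :
    IsReductionOf A C := by
  obtain ⟨hAB', n, hn⟩ := hAB
  obtain ⟨hBC', r, hr⟩ := hBC
  refine ⟨hAB'.trans hBC', n + r, ?_⟩
  have hpow : ∀ k, C ^ (k + r) = B ^ k * C ^ r := by
    intro k
    induction k with
    | zero => simp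
    | succ k ih =>
      rw [show k + 1 + r = (k + r) + 1 by ring, pow_succ, ih, mul_assoc, ← pow_succ, hr]; ring
  rw [show n + r + 1 = (n + 1) + r by ring, hpow, hpow, hn, mul_assoc]

end Substitution

/-! ### Analytic independence of generators of a minimal reduction. -/

section MinimalReduction

variable {R : Type*} [CommRing R] [IsLocalRing R] [IsNoetherianRing R]
  [Infinite (ResidueField R)]

/-- A minimal generating family of a minimal reduction is analytically independent. -/
theorem coeff_mem_maximalIdeal_of_isMinimalReductionOf {I J : Ideal R}
    (hJ : IsMinimalReductionOf J I) {s : ℕ} {y : Fin s → R} (hy : Ideal.span (Set.range y) = J)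
    (hmin : ∀ (t : ℕ) (y' : Fin t → R), Ideal.span (Set.range y') = J → s ≤ t)
    {n : ℕ} {f : MvPolynomial (Fin s) R} (hf : f.IsHomogeneous (n + 1))
    (hfy : MvPolynomial.eval y f ∈ maximalIdeal R * J ^ (n + 1)) (e : Fin s →₀ ℕ) :
    f.coeff e ∈ maximalIdeal R := by
  by_contra hcoeff
  set g := MvPolynomial.map (residue R) f with hg
  have hg0 : g ≠ 0 := by
    intro h
    apply hcoeff
    rw [← residue_eq_zero_iff, ← MvPolynomial.coeff_map, ← hg, h, MvPolynomial.coeff_zero]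
  have hgh : g.IsHomogeneous (n + 1) := hf.map _
  -- A nonzero form over the infinite residue field has a nonzero value. The point is then scaled so
  -- that its `i`-th coordinate is 1 and lifted to `d`, so `f` takes a unit value at `d`.
  obtain ⟨c, hc⟩ : ∃ c, MvPolynomial.eval c g ≠ 0 := by
    by_contra! h
    exact hg0 (MvPolynomial.funext fun x => by rw [h x, map_zero])
  obtain ⟨i, hi⟩ : ∃ i, c i ≠ 0 := by
    by_contra! h
    have := eval_sub_eval_mul_pow_mem (P := ⊥) (Q := ⊤) (y := c) (c := 0) (z := 0)
      (fun _ => trivial) trivial (fun i => by simp [h i]) hgh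
    apply hc
    simpa using this
  have hnorm := eval_sub_eval_mul_pow_mem (P := ⊥) (Q := ⊤) (y := c) (c := fun j => c j / c i)
      (z := c i) (fun _ => trivial) trivial (fun j => by simp [div_mul_cancel₀ _ hi]) hgh
  rw [Ideal.bot_mul, Ideal.mem_bot, sub_eq_zero] at hnorm
  have hd0 : MvPolynomial.eval (fun j => c j / c i) g ≠ 0 := by
    intro h; apply hc; rw [hnorm, h, zero_mul]
  obtain ⟨d, hdi, hd⟩ : ∃ d : Fin s → R, d i = 1 ∧ ∀ j, residue R (d j) = c j / c i := by
    choose d hd using fun j => residue_surjective (c j / c i)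
    refine ⟨Function.update d i 1, by simp, fun j => ?_⟩
    by_cases hji : j = i
    · subst hji; simp [div_self hi]
    · simp [hji, hd]
  have hdf : IsUnit (MvPolynomial.eval d f) := by
    rw [← notMem_maximalIdeal, ← residue_eq_zero_iff]
    have : residue R (MvPolynomial.eval d f) = MvPolynomial.eval (fun j => c j / c i) g := by
      rw [hg, MvPolynomial.eval_map, ← funext hd]
      exact MvPolynomial.eval₂_comp (residue R) d f
    rwa [this]
  -- Since `f(d)` is a unit, `y i ^ (n + 1)` lies in `P J ^ n + 𝔪 J ^ (n + 1)`. By Nakayama the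
  -- ideal `P` of these `s - 1` elements is a reduction of `J`, hence of `I`, so it equals `J`
  -- against the choice of `s`.
  let y' : {j : Fin s // j ≠ i} → R := fun j => y j - d j * y i
  set P := Ideal.span (Set.range y') with hP
  have hyJ : ∀ j, y j ∈ J := fun j => hy ▸ Ideal.subset_span ⟨j, rfl⟩
  have hyc : ∀ j, y j - d j * y i ∈ P := by
    intro j
    by_cases hji : j = i
    · subst hji; simp [hdi]
    · exact Ideal.subset_span ⟨⟨j, hji⟩, rfl⟩
  have hPJ : P ≤ J := by
    rw [hP, Ideal.span_le]
    rintro _ ⟨j, rfl⟩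
    exact J.sub_mem (hyJ _) (J.mul_mem_left _ (hyJ i))
  have hJP : J = P ⊔ Ideal.span {y i} := by
    refine le_antisymm ?_ (sup_le hPJ ((Ideal.span_singleton_le_iff_mem _).mpr (hyJ i)))
    rw [← hy, Ideal.span_le]
    rintro _ ⟨j, rfl⟩
    rw [← sub_add_cancel (y j) (d j * y i)]
    exact Ideal.add_mem _ (le_sup_left (a := P) (hyc j)) (Ideal.mul_mem_left _ _
      (le_sup_right (a := P) (Ideal.mem_span_singleton_self _)))
  have hz : y i ^ (n + 1) ∈ P * J ^ n ⊔ maximalIdeal R * J ^ (n + 1) := by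
    have h1 := eval_sub_eval_mul_pow_mem hyJ (hyJ i) hyc hf
    have h2 : MvPolynomial.eval d f * y i ^ (n + 1) ∈
        P * J ^ n ⊔ maximalIdeal R * J ^ (n + 1) := by
      rw [← sub_sub_cancel (MvPolynomial.eval y f) (MvPolynomial.eval d f * y i ^ (n + 1))]
      exact Ideal.sub_mem _ (le_sup_right (a := P * J ^ n) hfy) (le_sup_left (a := P * J ^ n) h1)
    exact (Ideal.unit_mul_mem_iff_mem _ hdf).mp h2
  have hle : J ^ (n + 1) ≤ P * J ^ n ⊔ maximalIdeal R * J ^ (n + 1) := by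
    have h1 := sup_span_singleton_pow_le P (y i) n
    rw [← hJP] at h1
    exact h1.trans (sup_le le_sup_left ((Ideal.span_singleton_le_iff_mem _).mpr hz))
  have hnak : J ^ (n + 1) ≤ P * J ^ n :=
    Submodule.le_of_le_smul_of_le_jacobson_bot (I := maximalIdeal R) (IsNoetherian.noetherian _)
      (by rw [IsLocalRing.jacobson_eq_maximalIdeal _ bot_ne_top]) hle
  have hred : IsReductionOf P J := ⟨hPJ, n, le_antisymm hnak (by
    rw [pow_succ']; exact Ideal.mul_mono_left hPJ)⟩
  have hPeq : P = J := le_antisymm hPJ (hJ.2 (hred.trans hJ.1) hPJ)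
  have hcard : Fintype.card {j : Fin s // j ≠ i} = s - 1 := by simp
  have := hmin (s - 1) (y' ∘ (Fintype.equivFinOfCardEq hcard).symm) (by
    rw [Set.range_comp, Equiv.range_eq_univ, Set.image_univ]; exact hPeq)
  have := i.2
  omega

end MinimalReduction

/-! ### Growth of lengths: a minimal reduction has two generators. -/

section Growth

/-- With three variables available, two exponents below `k` are free and the third fills up the
degree. -/
theorem exists_injective_degree_eq {s k n : ℕ} (hs : 2 < s) (hkn : 2 * k ≤ n) :
    ∃ E : Fin k × Fin k → (Fin s →₀ ℕ), Function.Injective E ∧ ∀ u, (E u).degree = n + 1 := by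
  let E : Fin k × Fin k → (Fin s →₀ ℕ) := fun u =>
    Finsupp.single ⟨0, by omega⟩ (u.1 : ℕ) + Finsupp.single ⟨1, by omega⟩ (u.2 : ℕ) +
      Finsupp.single ⟨2, by omega⟩ (n + 1 - u.1 - u.2 : ℕ)
  refine ⟨E, ?_, ?_⟩
  · intro u v huv
    have h0 := DFunLike.congr_fun huv ⟨0, by omega⟩
    have h1 := DFunLike.congr_fun huv ⟨1, by omega⟩
    simp [E] at h0 h1
    exact Prod.ext (Fin.ext h0) (Fin.ext h1)
  · intro u
    have := u.1.2
    have := u.2.2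
    simp only [E, map_add, Finsupp.degree_single]
    omega

variable {R : Type*} [CommRing R]

theorem length_quotient_span_pair_pow_le (x y : R) (n : ℕ) :
    Module.length R (R ⧸ Ideal.span {x, y} ^ n) ≤
      (n ^ 2 : ℕ) * Module.length R (R ⧸ Ideal.span {x, y}) := by
  set q := Ideal.span {x, y} with hq
  have hgen : ∀ n : ℕ, q ^ n = Ideal.span (Set.range fun i : Fin (n + 1) =>
      x ^ (i : ℕ) * y ^ (n - i : ℕ)) := by
    intro n
    induction n with
    | zero => simp
    | succ n ih =>
      refine le_antisymm ?_ ?_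
      · rw [pow_succ', ih, hq, Ideal.span_mul_span, Ideal.span_le]
        rintro _ ⟨s, hs, _, ⟨i, rfl⟩, rfl⟩
        have hi := i.2
        apply Ideal.subset_span
        rcases hs with rfl | rfl
        · exact ⟨⟨i + 1, by omega⟩, by
            change s ^ ((i : ℕ) + 1) * y ^ (n + 1 - (i + 1)) = _
            rw [Nat.add_sub_add_right]; ring⟩
        · exact ⟨⟨i, by omega⟩, by
            simp only [show n + 1 - (i : ℕ) = (n - i) + 1 by omega]; ring⟩
      · rw [Ideal.span_le]
        rintro _ ⟨i, rfl⟩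
        have hi := i.2
        have hx : x ∈ q := Ideal.subset_span (by simp)
        have hy : y ∈ q := Ideal.subset_span (by simp)
        have := Ideal.mul_mem_mul (Ideal.pow_mem_pow hx i) (Ideal.pow_mem_pow hy (n + 1 - i))
        rwa [← pow_add, show (i : ℕ) + (n + 1 - i) = n + 1 by omega] at this
  induction n with
  | zero => simp
  | succ n ih =>
    rw [length_quotient_eq_add (Ideal.pow_le_pow_right (Nat.le_succ n))]
    have h1 := idealQuotientLength_span_le
      (fun i : Fin (n + 1) => x ^ (i : ℕ) * y ^ (n - i : ℕ)) q
    rw [← hgen, ← pow_succ', Fintype.card_fin] at h1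
    calc _ ≤ ((n + 1 : ℕ) : ℕ∞) * Module.length R (R ⧸ q) +
          (n ^ 2 : ℕ) * Module.length R (R ⧸ q) := add_le_add h1 ih
      _ = ((n + 1 + n ^ 2 : ℕ) : ℕ∞) * Module.length R (R ⧸ q) := by push_cast; ring
      _ ≤ _ := by gcongr; nlinarith

variable [IsLocalRing R] [IsNoetherianRing R]

theorem exists_span_pair_radical_of_ringKrullDim_eq_two (hdim : ringKrullDim R = 2) :
    ∃ x y : R, maximalIdeal R ≤ (Ideal.span {x, y}).radical ∧
      Ideal.span {x, y} ≤ maximalIdeal R := by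
  obtain ⟨s, hs, hcard⟩ := Ideal.exists_finset_card_eq_height_of_isNoetherianRing (maximalIdeal R)
  have h2 : s.card = 2 := by
    have h := IsLocalRing.maximalIdeal_height_eq_ringKrullDim (R := R)
    rw [hdim, ← hcard] at h
    have h' : (s.card : ℕ∞) = 2 := WithBot.coe_injective h
    exact_mod_cast h'
  classical
  obtain ⟨x, y, -, rfl⟩ := Finset.card_eq_two.mp h2
  simp only [Finset.coe_insert, Finset.coe_singleton] at hs
  refine ⟨x, y, ?_, hs.1.2⟩
  rw [Ideal.radical_eq_sInf]
  refine le_sInf fun P ⟨hP, hPp⟩ => hs.2 ⟨hPp, hP⟩ (le_maximalIdeal hPp.ne_top)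

variable [Infinite (ResidueField R)]

theorem mul_self_le_idealQuotientLength_pow {I J : Ideal R}
    (hJ : IsMinimalReductionOf J I) {s : ℕ} {y : Fin s → R} (hy : Ideal.span (Set.range y) = J)
    (hmin : ∀ (t : ℕ) (y' : Fin t → R), Ideal.span (Set.range y') = J → s ≤ t) (hs : 2 < s)
    (hJm : J ≤ maximalIdeal R) (hfin : ∀ n, Module.length R (R ⧸ J ^ n) ≠ ⊤) (k n : ℕ)
    (hkn : 2 * k ≤ n) :
    ((k * k : ℕ) : ℕ∞) ≤ idealQuotientLength (J ^ (n + 1)) (J ^ (n + 1 + 1)) := by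
  obtain ⟨E, hE, hEdeg⟩ := exists_injective_degree_eq hs hkn
  let f : (Fin k × Fin k → R) → MvPolynomial (Fin s) R := fun c =>
    ∑ u, MvPolynomial.monomial (E u) (c u)
  have hf : ∀ c, (f c).IsHomogeneous (n + 1) := fun c =>
    MvPolynomial.IsHomogeneous.sum _ _ _ fun u _ =>
      MvPolynomial.isHomogeneous_monomial _ (hEdeg u)
  let m : Fin k × Fin k → R := fun u => MvPolynomial.eval y (MvPolynomial.monomial (E u) 1)
  have hm : ∀ u, m u ∈ J ^ (n + 1) := by
    intro u
    have hyJ : ∀ j, y j ∈ J := fun j => hy ▸ Ideal.subset_span ⟨j, rfl⟩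
    have := eval_sub_eval_mul_pow_mem (P := J) (Q := J) (c := 0) (z := 0) hyJ J.zero_mem
      (fun i => by simpa using hyJ i)
      (MvPolynomial.isHomogeneous_monomial (1 : R) (hEdeg u))
    simpa [pow_succ'] using this
  have h := card_le_idealQuotientLength m hm fun c hc u => by
    have h1 : MvPolynomial.eval y (f c) ∈ maximalIdeal R * J ^ (n + 1) := by
      simpa [f, m, MvPolynomial.eval_monomial] using hc
    have h2 := coeff_mem_maximalIdeal_of_isMinimalReductionOf hJ hy hmin (hf c) h1 (E u)
    simpa [f, MvPolynomial.coeff_sum, MvPolynomial.coeff_monomial, hE.eq_iff] using h2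
  rw [Fintype.card_prod, Fintype.card_fin] at h
  refine h.trans ?_
  have hJJ : J ^ (n + 1 + 1) ≤ maximalIdeal R * J ^ (n + 1) := by
    rw [pow_succ']; exact Ideal.mul_mono_left hJm
  have hJ' : maximalIdeal R * J ^ (n + 1) ≤ J ^ (n + 1) := Ideal.mul_le_right
  rw [idealQuotientLength_add hJ' hJJ (hfin _)]
  exact le_self_add

/-- Three or more analytically independent generators would make `λ(R / J ^ n)` grow cubically,
while comparison with a system of two parameters bounds it quadratically. -/
theorem exists_eq_span_pair_of_isMinimalReductionOf (hdim : ringKrullDim R = 2) {I J : Ideal R}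
    (hJ : IsMinimalReductionOf J I) (hrad : maximalIdeal R ≤ J.radical)
    (hJm : J ≤ maximalIdeal R) : ∃ a b, J = Ideal.span {a, b} := by
  have hex : ∃ s, ∃ y : Fin s → R, Ideal.span (Set.range y) = J := by
    obtain ⟨S, hS⟩ := (IsNoetherian.noetherian J : J.FG)
    refine ⟨S.card, fun i => (S.equivFin.symm i : R), ?_⟩
    rw [← hS]
    congr 1
    ext r
    constructor
    · rintro ⟨i, rfl⟩; exact (S.equivFin.symm i).2
    · intro hr; exact ⟨S.equivFin ⟨r, hr⟩, by simp⟩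
  classical
  set s := Nat.find hex with hs
  obtain ⟨y, hy⟩ := Nat.find_spec hex
  have hmin : ∀ (t : ℕ) (y' : Fin t → R), Ideal.span (Set.range y') = J → s ≤ t :=
    fun t y' h => Nat.find_min' hex ⟨y', h⟩
  have hs2 : s ≤ 2 := by
    by_contra! hs2
    obtain ⟨p, q, hpq, hpqm⟩ := exists_span_pair_radical_of_ringKrullDim_eq_two hdim
    obtain ⟨t, ht⟩ := Ideal.exists_pow_le_of_le_radical_of_fg hrad
      (IsNoetherian.noetherian (maximalIdeal R))
    obtain ⟨l, hl⟩ := ENat.ne_top_iff_exists.mp (length_quotient_ne_top hpq)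
    have hupper : ∀ n, Module.length R (R ⧸ J ^ n) ≤ ((t * n) ^ 2 * l : ℕ) := by
      intro n
      have hle : Ideal.span {p, q} ^ (t * n) ≤ J ^ n := by
        rw [pow_mul]
        exact Ideal.pow_right_mono ((Ideal.pow_right_mono hpqm t).trans ht) n
      have h1 := length_quotient_eq_add hle
      have h2 := length_quotient_span_pair_pow_le p q (t * n)
      rw [← hl] at h2
      rw [Nat.cast_mul]
      exact (le_of_le_of_eq le_add_self h1.symm).trans h2
    have hlower := mul_self_le_idealQuotientLength_pow hJ hy hmin hs2 hJm fun n =>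
      ne_top_of_le_ne_top (ENat.natCast_ne_top _) (hupper n)
    have hsum : ∀ k j, ((j * (k * k) : ℕ) : ℕ∞) ≤ Module.length R (R ⧸ J ^ (2 * k + 1 + j)) := by
      intro k j
      induction j with
      | zero => simp
      | succ j ih =>
        have h1 := hlower k (2 * k + j) (by omega)
        rw [show 2 * k + 1 + (j + 1) = 2 * k + j + 1 + 1 by ring,
          length_quotient_eq_add (Ideal.pow_le_pow_right (Nat.le_succ (2 * k + j + 1))),
          show (j + 1) * (k * k) = k * k + j * (k * k) by ring, Nat.cast_add]
        rw [show 2 * k + 1 + j = 2 * k + j + 1 by ring] at ih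
        exact add_le_add h1 ih
    have key : ∀ k j, j * (k * k) ≤ (t * (2 * k + 1 + j)) ^ 2 * l := fun k j => by
      exact_mod_cast (hsum k j).trans (hupper _)
    -- At `k = j = N` the inequality `key` reads `N³ ≤ t² (3N + 1)² l ≤ 16 t² l N²`, and the last
    -- term is less than `N³`.
    set N := 16 * t ^ 2 * l + 1 with hN
    have := key N N
    have hN1 : 1 ≤ N := by omega
    have h3 : (t * (2 * N + 1 + N)) ^ 2 * l ≤ 16 * t ^ 2 * l * (N * N) := by
      calc (t * (2 * N + 1 + N)) ^ 2 * l ≤ (t * (4 * N)) ^ 2 * l := by gcongr; omega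
        _ = _ := by ring
    have h4 : N * (N * N) = 16 * t ^ 2 * l * (N * N) + N * N := by
      conv_lhs => rw [hN]
      rw [← hN]; ring
    have : 0 < N * N := by positivity
    omega
  have hext : ∀ t ≤ 2, ∀ y : Fin t → R, ∃ a b, Ideal.span (Set.range y) = Ideal.span {a, b} := by
    intro t ht y
    interval_cases t
    · exact ⟨0, 0, by simp⟩
    · exact ⟨y 0, y 0, by simp [Set.range_unique]⟩
    · exact ⟨y 0, y 1, by congr 1; ext r; simp [Fin.exists_fin_two, eq_comm]⟩
  obtain ⟨a, b, hab⟩ := hext s hs2 y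
  exact ⟨a, b, by rw [← hy]; exact hab⟩

end Growth

/-! ### The graded determinant trick. -/

section IntegerPowers

variable {R : Type*} [CommRing R]

/-- The powers of an ideal, extended by `⊥` to negative exponents. -/
def idealZPow (I : Ideal R) (e : ℤ) : Ideal R := if e < 0 then ⊥ else I ^ e.toNat

theorem idealZPow_natCast (I : Ideal R) (n : ℕ) : idealZPow I n = I ^ n := by
  simp [idealZPow]

theorem idealZPow_mono {I J : Ideal R} (h : J ≤ I) (e : ℤ) : idealZPow J e ≤ idealZPow I e := by
  unfold idealZPow
  split_ifs
  · exact le_rfl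
  · exact Ideal.pow_right_mono h _

theorem idealZPow_mul_le (I : Ideal R) (e f : ℤ) :
    idealZPow I e * idealZPow I f ≤ idealZPow I (e + f) := by
  by_cases he : e < 0
  · simp [idealZPow, he]
  by_cases hf : f < 0
  · simp [idealZPow, hf]
  rw [idealZPow, idealZPow, idealZPow, if_neg he, if_neg hf, if_neg (by omega), ← pow_add,
    ← Int.toNat_add (by omega) (by omega)]

theorem prod_mem_idealZPow {ι : Type*} (I : Ideal R) (s : Finset ι) (a : ι → R) (e : ι → ℤ)
    (h : ∀ i ∈ s, a i ∈ idealZPow I (e i)) : ∏ i ∈ s, a i ∈ idealZPow I (∑ i ∈ s, e i) := by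
  classical
  induction s using Finset.induction_on with
  | empty => simp [idealZPow]
  | insert i s hi ih =>
    rw [Finset.prod_insert hi, Finset.sum_insert hi]
    exact idealZPow_mul_le I _ _ (Ideal.mul_mem_mul (h i (by simp))
      (ih fun j hj => h j (by simp [hj])))

variable {ι : Type*} [DecidableEq ι]

theorem prod_sub_sub_prod_mem {I J : Ideal R} (hJI : J ≤ I) (s : Finset ι) (x c : ι → R)
    (hx : ∀ i, x i ∈ I) (hc : ∀ i, c i ∈ J) :
    ∏ i ∈ s, (x i - c i) - ∏ i ∈ s, x i ∈ J * I ^ (s.card - 1) := by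
  induction s using Finset.induction_on with
  | empty => simp
  | insert i s hi ih =>
    rw [Finset.prod_insert hi, Finset.prod_insert hi, Finset.card_insert_of_notMem hi,
      Nat.add_sub_cancel]
    have e : (x i - c i) * ∏ i ∈ s, (x i - c i) - x i * ∏ i ∈ s, x i =
      x i * (∏ i ∈ s, (x i - c i) - ∏ i ∈ s, x i) - c i * ∏ i ∈ s, (x i - c i) := by ring
    rw [e]
    refine Ideal.sub_mem _ ?_ (Ideal.mul_mem_mul (hc i) ?_)
    · rcases s.eq_empty_or_nonempty with rfl | hs
      · simp
      · have := Ideal.mul_mem_mul (hx i) ih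
        rwa [mul_left_comm, ← pow_succ', Nat.sub_add_cancel hs.card_pos] at this
    · rw [← Finset.prod_const]
      exact Ideal.prod_mem_prod fun j _ => I.sub_mem (hx j) (hJI (hc j))

theorem pow_card_le_span_prod (I : Ideal R) (s : Finset ι) :
    I ^ s.card ≤ Ideal.span {w | ∃ x : ι → R, (∀ i, x i ∈ I) ∧ w = ∏ i ∈ s, x i} := by
  induction s using Finset.induction_on with
  | empty =>
    rw [Finset.card_empty, pow_zero, Ideal.one_eq_top]
    refine ((Ideal.eq_top_iff_one _).mpr (Ideal.subset_span ?_)).ge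
    exact ⟨0, by simp, by simp⟩
  | insert i s hi ih =>
    rw [Finset.card_insert_of_notMem hi, pow_succ']
    refine (Ideal.mul_mono_right ih).trans ?_
    conv_lhs => rw [← Ideal.span_eq I]
    rw [Ideal.span_mul_span, Ideal.span_le]
    rintro _ ⟨a, ha, _, ⟨x, hx, rfl⟩, rfl⟩
    refine Ideal.subset_span ⟨Function.update x i a, fun j => ?_, ?_⟩
    · by_cases hj : j = i
      · subst hj; simpa using ha
      · simpa [hj] using hx j
    · rw [Finset.prod_insert hi, Function.update_self]
      congr 1
      exact Finset.prod_congr rfl fun j hj =>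
        (Function.update_of_ne (by rintro rfl; exact hi hj) _ _).symm

variable [Fintype ι]

/-- With row weights `r` and column weights `c`, every permutation term has the same total weight.
-/
theorem det_mem_idealZPow (I : Ideal R) (B : Matrix ι ι R) (r c : ι → ℤ)
    (h : ∀ i j, B i j ∈ idealZPow I (r i - c j)) :
    B.det ∈ idealZPow I (∑ i, r i - ∑ i, c i) := by
  rw [Matrix.det_apply]
  refine Ideal.sum_mem _ fun σ _ => ?_
  have := prod_mem_idealZPow I Finset.univ (fun i => B (σ i) i) (fun i => r (σ i) - c i)
    fun i _ => h _ _
  rw [Finset.sum_sub_distrib, Equiv.sum_comp σ r] at this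
  exact Submodule.smul_of_tower_mem _ _ this

theorem adjugate_mem_idealZPow (I : Ideal R) (B : Matrix ι ι R) (r c : ι → ℤ)
    (h : ∀ i j, B i j ∈ idealZPow I (r i - c j)) (j i : ι) :
    B.adjugate j i ∈ idealZPow I (∑ i, r i - ∑ i, c i - r i + c j) := by
  rw [Matrix.adjugate_apply]
  -- The unit row gets weight `c j`, so that its entry 1 in column `j` has weight zero.
  have := det_mem_idealZPow I (B.updateRow i (Pi.single j 1)) (Function.update r i (c j)) c ?_
  · convert this using 2
    rw [← Finset.add_sum_erase _ _ (Finset.mem_univ i),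
      ← Finset.add_sum_erase _ (Function.update r i (c j)) (Finset.mem_univ i),
      Finset.sum_congr rfl fun k hk =>
        Function.update_of_ne (Finset.ne_of_mem_erase hk) (c j) r, Function.update_self]
    ring
  · intro k l
    by_cases hk : k = i
    · subst hk
      rw [Matrix.updateRow_self, Function.update_self]
      by_cases hl : l = j
      · subst hl; simp [idealZPow]
      · simp [hl]
    · rw [Matrix.updateRow_ne hk, Function.update_of_ne hk]
      exact h k l

theorem det_diagonal_sub_sub_prod_mem {I J : Ideal R} (hJI : J ≤ I) (x : ι → R)
    (hx : ∀ i, x i ∈ I) (C : Matrix ι ι R) (d : ι → ℕ)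
    (hC : ∀ i j, C i j ∈ idealZPow J ((d i + 1 : ℕ) - d j)) :
    (Matrix.diagonal x - C).det - ∏ i, x i ∈ J * I ^ (Fintype.card ι - 1) := by
  have hB : ∀ i j, (Matrix.diagonal x - C) i j ∈ idealZPow I ((d i + 1 : ℕ) - d j) := by
    intro i j
    refine Ideal.sub_mem _ ?_ (idealZPow_mono hJI _ (hC i j))
    by_cases hij : i = j
    · subst hij
      have := idealZPow_natCast I 1
      simp_all
    · simp [hij]
  rw [← Matrix.det_diagonal, Matrix.det_apply, Matrix.det_apply, ← Finset.sum_sub_distrib]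
  refine Ideal.sum_mem _ fun σ _ => ?_
  rw [← smul_sub]
  refine Submodule.smul_of_tower_mem _ _ ?_
  by_cases hσ : σ = 1
  · subst hσ
    have := prod_sub_sub_prod_mem hJI Finset.univ x (fun i => C i i) hx fun i => by
      have h := hC i i
      have h1 := idealZPow_natCast J 1
      simp_all
    simpa using this
  · obtain ⟨i₀, hi₀⟩ : ∃ i, σ i ≠ i := by
      by_contra! h
      exact hσ (Equiv.ext h)
    have hdiag : ∏ i, Matrix.diagonal x (σ i) i = 0 :=
      Finset.prod_eq_zero (Finset.mem_univ i₀) (Matrix.diagonal_apply_ne _ hi₀)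
    rw [hdiag, sub_zero]
    -- A permutation cannot strictly lower `d` at every moved point, as it preserves `∑ d`. At the
    -- point found, the entry comes from `C` with exponent at least 1, which supplies the factor
    -- `J`.
    obtain ⟨i, hi, hdi⟩ : ∃ i, σ i ≠ i ∧ d i ≤ d (σ i) := by
      by_contra! h
      have h1 : ∑ i, d (σ i) < ∑ i, d i := by
        refine Finset.sum_lt_sum (fun i _ => ?_) ⟨i₀, Finset.mem_univ _, h i₀ hi₀⟩
        by_cases hi : σ i = i
        · rw [hi]
        · exact (h i hi).le
      exact absurd (Equiv.sum_comp σ d) h1.ne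
    rw [← Finset.mul_prod_erase _ _ (Finset.mem_univ i)]
    obtain ⟨e, he⟩ := Nat.exists_eq_add_of_le hdi
    have h1 : (Matrix.diagonal x - C) (σ i) i ∈ J * I ^ e := by
      have h := hC (σ i) i
      rw [he, show ((d i + e + 1 : ℕ) : ℤ) - d i = (e + 1 : ℕ) by push_cast; ring,
        idealZPow_natCast, pow_succ'] at h
      rw [Matrix.sub_apply, Matrix.diagonal_apply_ne _ hi, zero_sub]
      exact Ideal.neg_mem_iff _ |>.mpr (Ideal.mul_mono_right (Ideal.pow_right_mono hJI e) h)
    have h2 := prod_mem_idealZPow I (Finset.univ.erase i)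
      (fun j => (Matrix.diagonal x - C) (σ j) j) (fun j => (d (σ j) + 1 : ℕ) - d j)
      fun j _ => hB _ _
    have h3 : ∑ j ∈ Finset.univ.erase i, (((d (σ j) + 1 : ℕ) : ℤ) - d j) =
        Fintype.card ι - (e + 1 : ℕ) := by
      have h4 : ∑ j, (((d (σ j) + 1 : ℕ) : ℤ) - d j) = Fintype.card ι := by
        push_cast
        rw [Finset.sum_sub_distrib, Finset.sum_add_distrib,
          Equiv.sum_comp σ (fun j => (d j : ℤ))]
        simp
      rw [← Finset.add_sum_erase _ _ (Finset.mem_univ i), he] at h4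
      push_cast at h4 ⊢
      linarith
    rw [h3] at h2
    have h5 : J * I ^ e * idealZPow I (Fintype.card ι - (e + 1 : ℕ)) ≤
        J * I ^ (Fintype.card ι - 1) := by
      rw [mul_assoc]
      refine Ideal.mul_mono_right ?_
      have hcard : 0 < Fintype.card ι := Fintype.card_pos_iff.mpr ⟨i⟩
      rw [← idealZPow_natCast, ← idealZPow_natCast]
      refine (idealZPow_mul_le _ _ _).trans (le_of_eq ?_)
      congr 1
      push_cast [Nat.cast_sub (show 1 ≤ Fintype.card ι from hcard)]
      ring
    exact h5 (Ideal.mul_mem_mul h1 h2)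

theorem exists_sub_sum_mem_of_mem_sup_iSup {A : Ideal R} {P : ι → Ideal R} {m : ι → R} {w : R}
    (hw : w ∈ A ⊔ ⨆ j, P j * Ideal.span {m j}) :
    ∃ c : ι → R, (∀ j, c j ∈ P j) ∧ w - ∑ j, c j * m j ∈ A := by
  obtain ⟨a, ha, b, hb, rfl⟩ := Submodule.mem_sup.mp hw
  have hb' : ∃ c : ι → R, (∀ j, c j ∈ P j) ∧ b = ∑ j, c j * m j := by
    induction hb using Submodule.iSup_induction' with
    | mem j x hx =>
      obtain ⟨z, hz, rfl⟩ := Ideal.mem_mul_span_singleton.mp hx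
      refine ⟨Pi.single j z, fun k => ?_, ?_⟩
      · by_cases hk : k = j
        · subst hk; simpa using hz
        · simp [hk]
      · rw [Finset.sum_eq_single j] <;> simp +contextual
    | zero => exact ⟨0, by simp, by simp⟩
    | add x y _ _ hx hy =>
      obtain ⟨c, hc, rfl⟩ := hx (Submodule.add_mem_sup ha ‹_›)
      obtain ⟨c', hc', rfl⟩ := hy (Submodule.add_mem_sup ha ‹_›)
      exact ⟨c + c', fun j => (P j).add_mem (hc j) (hc' j), by
        simp [add_mul, Finset.sum_add_distrib]⟩
  obtain ⟨c, hc, rfl⟩ := hb'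
  exact ⟨c, hc, by simpa using ha⟩

/-- Let `F` be an `I`-filtration with `K I ≤ F 1` such that the quotients `F 1 / K I` and
`F (n + 1) / J F n`, `n ≥ 1`, are generated in total by `card ι` elements. Then
`K I ^ (n + 1) = K J I ^ n` for `n = card ι + 1`. -/
theorem mul_pow_card_eq_of_generators {K I J : Ideal R} (hJI : J ≤ I) (F : ℕ → Ideal R)
    (hIF : ∀ n, I * F n ≤ F (n + 1)) (hKF : K * I ≤ F 1) (d : ι → ℕ) (m : ι → R)
    (hm : ∀ i, m i ∈ F (d i + 1)) (h1 : F 1 ≤ K * I ⊔ Ideal.span (m '' {j | d j = 0}))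
    (hstep : ∀ n, F (n + 2) ≤ J * F (n + 1) ⊔ Ideal.span (m '' {j | d j = n + 1})) :
    K * I ^ (Fintype.card ι + 1 + 1) = K * J * I ^ (Fintype.card ι + 1) := by
  set ν := Fintype.card ι with hν
  have hsp : ∀ n : ℕ, Ideal.span (m '' {j | d j = n}) ≤
      ⨆ j, idealZPow J ((n : ℤ) - d j) * Ideal.span {m j} := by
    intro n
    rw [Ideal.span_le]
    rintro _ ⟨j, rfl, rfl⟩
    refine Submodule.mem_iSup_of_mem j ?_
    simp [idealZPow]
  have hgen : ∀ n : ℕ, F (n + 1) ≤ J ^ n * (K * I) ⊔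
      ⨆ j, idealZPow J ((n : ℤ) - d j) * Ideal.span {m j} := by
    intro n
    induction n with
    | zero => simpa using h1.trans (sup_le_sup_left (hsp 0) _)
    | succ n ih =>
      refine (hstep n).trans (sup_le ?_ ((hsp (n + 1)).trans le_sup_right))
      refine (Ideal.mul_mono_right ih).trans ?_
      rw [Ideal.mul_sup, ← mul_assoc, ← pow_succ', Submodule.mul_iSup]
      refine sup_le_sup_left (iSup_mono fun j => ?_) _
      rw [← mul_assoc]
      refine Ideal.mul_mono_left ?_
      have := idealZPow_mul_le J (1 : ℕ) ((n : ℤ) - d j)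
      rw [idealZPow_natCast, pow_one] at this
      refine this.trans (le_of_eq ?_)
      congr 1
      push_cast; ring
  have hmain : I ^ ν * (K * I ^ 2) ≤ K * J * I ^ (ν + 1) := by
    refine (Ideal.mul_mono_left (pow_card_le_span_prod I Finset.univ)).trans ?_
    conv_lhs => rw [← Ideal.span_eq (K * I ^ 2)]
    rw [Ideal.span_mul_span, Ideal.span_le]
    rintro _ ⟨_, ⟨x, hx, rfl⟩, v, hv, rfl⟩
    have hxm : ∀ i, x i * m i ∈ F (d i + 1 + 1) := fun i =>
      hIF _ (Ideal.mul_mem_mul (hx i) (hm i))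
    choose C hC hn using fun i => exists_sub_sum_mem_of_mem_sup_iSup (hgen _ (hxm i))
    -- Taking `v` in `K I ^ 2` rather than in `K I` makes its remainder lie in `J K I`; this costs
    -- one extra power of `I` in the conclusion.
    have hvF : v ∈ F (1 + 1) := by
      refine hIF 1 (Ideal.mul_mono_right hKF ?_)
      rw [show I * (K * I) = K * I ^ 2 by ring]
      exact hv
    obtain ⟨c, hc, hcv⟩ := exists_sub_sum_mem_of_mem_sup_iSup (hgen _ hvF)
    set B : Matrix ι ι R := Matrix.diagonal x - Matrix.of C with hB
    have hdet := det_diagonal_sub_sub_prod_mem hJI x hx (Matrix.of C) d hC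
    rw [← hB] at hdet
    have hBmem : ∀ i j, B i j ∈ idealZPow I (((d i + 1 : ℕ) : ℤ) - d j) := by
      intro i j
      refine Ideal.sub_mem _ ?_ (idealZPow_mono hJI _ (hC i j))
      by_cases hij : i = j
      · subst hij
        have := idealZPow_natCast I 1
        simp_all
      · simp [hij]
    have hsum : ∑ i, ((d i + 1 : ℕ) : ℤ) - ∑ i, (d i : ℤ) = ν := by
      push_cast
      rw [Finset.sum_add_distrib]
      simp [hν]
    have hDet : B.det ∈ I ^ ν := by
      have := det_mem_idealZPow I B _ _ hBmem
      rwa [hsum, idealZPow_natCast] at this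
    have hadj : ∀ j i, B.adjugate j i ∈ idealZPow I ((ν : ℤ) - (d i + 1 : ℕ) + d j) := by
      intro j i
      have := adjugate_mem_idealZPow I B _ _ hBmem j i
      rwa [hsum] at this
    -- Cayley–Hamilton with remainders: `B m` is the vector of errors in expressing `x i * m i` by
    -- the generators, and `adj(B) B = det B`.
    have hDm : ∀ j, B.det * m j = ∑ i, B.adjugate j i * (x i * m i - ∑ k, C i k * m k) := by
      intro j
      have e : ∀ i, (B.mulVec m) i = x i * m i - ∑ k, C i k * m k := by
        intro i
        rw [hB, Matrix.sub_mulVec, Pi.sub_apply, Matrix.mulVec_diagonal]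
        rfl
      have h := congrFun (Matrix.mulVec_mulVec m B.adjugate B) j
      rw [Matrix.adjugate_mul, Matrix.smul_mulVec, Matrix.one_mulVec, Pi.smul_apply,
        smul_eq_mul] at h
      rw [← h, Matrix.mulVec, dotProduct]
      simp only [e]
    have ht1 : (B.det - ∏ i, x i) * v ∈ K * J * I ^ (ν + 1) := by
      have h := Ideal.mul_mem_mul hdet hv
      refine (show J * I ^ (ν - 1) * (K * I ^ 2) ≤ _ from ?_) h
      calc J * I ^ (ν - 1) * (K * I ^ 2) = K * J * I ^ (ν - 1 + 2) := by ring
        _ ≤ K * J * I ^ (ν + 1) := Ideal.mul_mono_right (Ideal.pow_le_pow_right (by omega))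
    have ht2 : B.det * (v - ∑ j, c j * m j) ∈ K * J * I ^ (ν + 1) := by
      have h := Ideal.mul_mem_mul hDet hcv
      rwa [show I ^ ν * (J ^ 1 * (K * I)) = K * J * I ^ (ν + 1) by ring] at h
    have ht3 : ∀ j i, c j * (B.adjugate j i * (x i * m i - ∑ k, C i k * m k)) ∈
        K * J * I ^ (ν + 1) := by
      intro j i
      have h1 := idealZPow_mul_le I _ _
        (Ideal.mul_mem_mul (idealZPow_mono hJI _ (hc j)) (hadj j i))
      -- The weight `d j` cancels, and the remainder of `x i * m i`, in `J ^ (d i + 1) K I`, makes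
      -- up for the missing `d i` and contributes the factor `J`.
      rw [show ((1 : ℕ) : ℤ) - d j + ((ν : ℤ) - (d i + 1 : ℕ) + d j) = ν - d i by
        push_cast; ring] at h1
      have h2 := Ideal.mul_mem_mul h1 (hn i)
      rw [mul_assoc] at h2
      refine (?_ : idealZPow I ((ν : ℤ) - d i) * (J ^ (d i + 1) * (K * I)) ≤ _) h2
      calc idealZPow I ((ν : ℤ) - d i) * (J ^ (d i + 1) * (K * I))
          = K * J * I * (idealZPow I ((ν : ℤ) - d i) * J ^ d i) := by ring
        _ ≤ K * J * I * (idealZPow I ((ν : ℤ) - d i) * idealZPow I (d i : ℕ)) := by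
          rw [idealZPow_natCast]
          exact Ideal.mul_mono_right (Ideal.mul_mono_right (Ideal.pow_right_mono hJI _))
        _ ≤ K * J * I * idealZPow I ((ν : ℤ) - d i + d i) :=
          Ideal.mul_mono_right (idealZPow_mul_le _ _ _)
        _ = K * J * I ^ (ν + 1) := by
          rw [sub_add_cancel, idealZPow_natCast]; ring
    have e : (∏ i, x i) * v = B.det * (v - ∑ j, c j * m j) +
        ∑ j, ∑ i, c j * (B.adjugate j i * (x i * m i - ∑ k, C i k * m k)) -
          (B.det - ∏ i, x i) * v := by
      have : ∑ j, ∑ i, c j * (B.adjugate j i * (x i * m i - ∑ k, C i k * m k)) =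
          B.det * ∑ j, c j * m j := by
        rw [Finset.mul_sum]
        refine Finset.sum_congr rfl fun j _ => ?_
        rw [← Finset.mul_sum, ← hDm]; ring
      rw [this]; ring
    change (∏ i, x i) * v ∈ _
    rw [e]
    exact Ideal.sub_mem _ (Ideal.add_mem _ ht2
      (Ideal.sum_mem _ fun j _ => Ideal.sum_mem _ fun i _ => ht3 j i)) ht1
  refine le_antisymm ?_ ?_
  · rwa [show I ^ ν * (K * I ^ 2) = K * I ^ (ν + 1 + 1) by ring] at hmain
  · calc K * J * I ^ (ν + 1) ≤ K * I * I ^ (ν + 1) :=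
        Ideal.mul_mono_left (Ideal.mul_mono_right hJI)
      _ = K * I ^ (ν + 1 + 1) := by ring

end IntegerPowers

/-! ### Hilbert coefficients from first differences. -/

section HilbertCoefficients

variable {R : Type*} [CommRing R]

theorem isHilbertCoefficients_two_iff {K I : Ideal R} {h : ℕ → ℕ} {n₀ : ℕ} {p q : ℤ}
    (hlen : ∀ n ≥ n₀, Module.length R (R ⧸ K * I ^ n) = h n)
    (hdiff : ∀ n ≥ n₀, (h (n + 1) : ℤ) - h n = p * (n + 1) - q) (g : Fin 3 → ℤ) :
    IsHilbertCoefficients K I 2 g ↔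
      g = ![p, q, h n₀ - p * ((n₀ + 1).choose 2 : ℕ) + q * n₀] := by
  have hsum : ∀ (g : Fin 3 → ℤ) (n : ℕ), ∑ i : Fin (2 + 1), (-1) ^ (i : ℕ) * g i *
      ((n + 2 - 1 - (i : ℕ)).choose (2 - (i : ℕ)) : ℤ) =
        g 0 * ((n + 1).choose 2 : ℕ) - g 1 * n + g 2 := by
    intro g n
    rw [Fin.sum_univ_three]
    simp
    ring
  have hch : ∀ n : ℕ, (((n + 1 + 1).choose 2 : ℕ) : ℤ) = (n + 1).choose 2 + (n + 1) := by
    intro n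
    rw [Nat.choose_succ_succ' (n + 1) 1, Nat.choose_one_right]
    push_cast; ring
  have hpoly : ∀ n ≥ n₀, (h n : ℤ) = p * ((n + 1).choose 2 : ℕ) - q * n +
      (h n₀ - p * ((n₀ + 1).choose 2 : ℕ) + q * n₀) := by
    intro n hn
    induction n, hn using Nat.le_induction with
    | base => ring
    | succ n hn ih =>
      have := hdiff n hn
      rw [hch]
      push_cast
      linear_combination ih + this
  constructor
  · intro hg
    obtain ⟨N, hN⟩ := Filter.eventually_atTop.mp hg
    have hval : ∀ n ≥ max N n₀, (h n : ℤ) = g 0 * ((n + 1).choose 2 : ℕ) - g 1 * n + g 2 := by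
      intro n hn
      obtain ⟨k, hk, hk'⟩ := hN n (le_trans (le_max_left _ _) hn)
      rw [hlen n (le_trans (le_max_right _ _) hn)] at hk
      have hk'' : h n = k := by exact_mod_cast hk
      rw [hk'', hk', hsum]
    set M := max N n₀
    have hM : M ≥ n₀ := le_max_right _ _
    -- Three consecutive values determine a polynomial of degree at most two.
    have h0 := hval M le_rfl
    have h1 := hval (M + 1) (by omega)
    have h2 := hval (M + 1 + 1) (by omega)
    have d0 := hdiff M hM
    have d1 := hdiff (M + 1) (by omega)
    have hp := hpoly M hM
    rw [hch] at h1 h2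
    rw [hch] at h2
    push_cast at h0 h1 h2 d0 d1
    have e0 : g 0 = p := by linear_combination h1 * 2 - h0 - h2 + d1 - d0
    have e1 : g 1 = q := by linear_combination h1 - h0 - d0 + (M + 1) * e0
    have e2 : g 2 = h n₀ - p * ((n₀ + 1).choose 2 : ℕ) + q * n₀ := by
      linear_combination hp - h0 - ((M + 1).choose 2 : ℕ) * e0 + M * e1
    funext i
    fin_cases i
    · exact e0
    · exact e1
    · exact e2
  · rintro rfl
    refine Filter.eventually_atTop.mpr ⟨n₀, fun n hn => ⟨h n, hlen n hn, ?_⟩⟩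
    rw [hsum, hpoly n hn]
    rfl

end HilbertCoefficients

/-! ### The sum of the lengths `v n` and the main theorem. -/

section Main

variable {R : Type*} [CommRing R]

theorem le_sup_span_image_of_generators {A B : Ideal R} {ι κ : Type*} [Fintype ι]
    (f : ι → R) (hf : ∀ w ∈ A, ∃ c : ι → R, w - ∑ i, c i * f i ∈ B) (m : κ → R) (s : Set κ)
    (e : ι → κ) (he : ∀ i, e i ∈ s) (hm : ∀ i, m (e i) = f i) :
    A ≤ B ⊔ Ideal.span (m '' s) := by
  intro w hw
  obtain ⟨c, hc⟩ := hf w hw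
  rw [← sub_add_cancel w (∑ i, c i * f i)]
  refine Ideal.add_mem _ (le_sup_left (a := B) hc) (le_sup_right (a := B) ?_)
  refine Ideal.sum_mem _ fun i _ => Ideal.mul_mem_left _ _ (Ideal.subset_span ?_)
  exact ⟨e i, he i, hm i⟩

variable [IsLocalRing R]

theorem maximalIdeal_le_radical_maximalIdeal_mul_pow {I : Ideal R}
    (hI : maximalIdeal R ≤ I.radical) (n : ℕ) :
    maximalIdeal R ≤ (maximalIdeal R * I ^ n).radical := by
  rw [Ideal.radical_mul]
  refine le_inf Ideal.le_radical ?_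
  rcases Nat.eq_zero_or_pos n with rfl | hn
  · rw [pow_zero, Ideal.one_eq_top, Ideal.radical_top]
    exact le_top
  · rwa [Ideal.radical_pow _ hn.ne']

/-- The second difference of the Hilbert function of the Ratliff-Rush type closure. -/
theorem sum_length_eq_of_ratliffRush {a b : R} {F : ℕ → Ideal R}
    (hkos : ∀ u v : R, u * a + v * b = 0 → ∃ w, u = w * b ∧ v = -(w * a))
    (hJm : Ideal.span {a, b} ≤ maximalIdeal R) (hF0 : F 0 = maximalIdeal R)
    (hJF : ∀ n, Ideal.span {a, b} * F n ≤ F (n + 1))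
    (hcol : ∀ n, (F (n + 1)).colon (Ideal.span {a, b} : Set R) = F n) {H v : ℕ → ℕ} {e : ℕ}
    (hH : ∀ n, Module.length R (R ⧸ F n) = H n)
    (hv : ∀ n, idealQuotientLength (F (n + 1)) (Ideal.span {a, b} * F n) = v n)
    (he : Module.length R (R ⧸ Ideal.span {a, b}) = e) (N : ℕ) :
    ((∑ n ∈ Finset.range (N + 1), v n : ℕ) : ℤ) = (N + 1) * e + H N - H (N + 1) + 1 := by
  -- Here `λ(R / J F n)` is computed through `F (n + 1)` and through `J`.
  have hw : ∀ n, ∃ w : ℕ, idealQuotientLength (Ideal.span {a, b}) (Ideal.span {a, b} * F n) = w ∧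
      v n + H (n + 1) = w + e := by
    intro n
    have h1 := length_quotient_eq_add (hJF n)
    have h2 := length_quotient_eq_add
      (show Ideal.span {a, b} * F n ≤ Ideal.span {a, b} from Ideal.mul_le_left)
    rw [hv, hH] at h1
    rw [h1, he] at h2
    obtain ⟨w, hw⟩ : ∃ w : ℕ,
        (w : ℕ∞) = idealQuotientLength (Ideal.span {a, b}) (Ideal.span {a, b} * F n) := by
      apply ENat.ne_top_iff_exists.mp
      intro h
      rw [h, top_add] at h2
      exact absurd h2 (by exact_mod_cast ENat.natCast_ne_top _)
    rw [← hw] at h2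
    exact ⟨w, hw.symm, by exact_mod_cast h2⟩
  choose w hw hvw using hw
  have h0 : H 0 = 1 := by
    have h1 : Module.length R (R ⧸ F 0) = 1 := by
      rw [hF0, Module.length_eq_one_iff, isSimpleModule_iff_isCoatom]
      exact (maximalIdeal.isMaximal R).out
    rw [hH] at h1
    exact_mod_cast h1
  -- In degree zero the colon `F 0 : J` is the whole ring; this boundary case produces the final `+
  -- 1`.
  have hw0 : H 0 + H 0 = w 0 := by
    have h1 := two_mul_length_quotient_eq (F := F 0) hkos
    have h2 : (F 0).colon (Ideal.span {a, b} : Set R) = ⊤ := by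
      refine (Ideal.eq_top_iff_one _).mpr (Submodule.mem_colon.mpr fun s hs => ?_)
      rw [one_smul, hF0]
      exact hJm hs
    have h3 : Module.length R (R ⧸ (F 0).colon (Ideal.span {a, b} : Set R)) = 0 := by
      rw [h2]
      exact Module.length_eq_zero_iff.mpr inferInstance
    rw [h3, hH, hw, zero_add] at h1
    exact_mod_cast h1
  have hws : ∀ n, H (n + 1) + H (n + 1) = H n + w (n + 1) := by
    intro n
    have h1 := two_mul_length_quotient_eq (F := F (n + 1)) hkos
    rw [hcol, hH, hH, hw] at h1
    exact_mod_cast h1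
  induction N with
  | zero =>
    have := hvw 0
    rw [zero_add, Finset.sum_range_one]
    rw [zero_add] at this
    zify at this hw0 h0
    push_cast
    linear_combination this - hw0 + h0
  | succ N ih =>
    have h1 := hvw (N + 1)
    have h2 := hws N
    rw [Finset.sum_range_succ, Nat.cast_add, ih]
    push_cast
    zify at h1 h2
    linear_combination h1 - h2

end Main

theorem corollary3p6 {R : Type*} [CommRing R] [IsLocalRing R]
    [Infinite (IsLocalRing.ResidueField R)]
    (hCM : IsCohenMacaulayLocalRing R) (hdim : ringKrullDim R = 2)
    (I J : Ideal R) (hI : IsMaximalIdealPrimary I) (hJ : IsMinimalReductionOf J I) :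
    (∃! g : Fin 3 → ℤ, IsHilbertCoefficients (IsLocalRing.maximalIdeal R) I 2 g) ∧
    ∀ g : Fin 3 → ℤ, IsHilbertCoefficients (IsLocalRing.maximalIdeal R) I 2 g →
      (∃ l : ℕ,
        idealQuotientLength (IsLocalRing.maximalIdeal R * I) (IsLocalRing.maximalIdeal R * J) = l ∧
        (kReductionNumber (IsLocalRing.maximalIdeal R) J I : ℤ) ≤ g 1 + 2 - l) ∧
      (HasAlmostMinimalMultiplicity (IsLocalRing.maximalIdeal R) I →
        (kReductionNumber (IsLocalRing.maximalIdeal R) J I : ℤ) ≤ g 1 + 1) := by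
  have := hCM.isNoetherianRing
  have hIm : I ≤ maximalIdeal R := Ideal.le_radical.trans hI.radical_eq.le
  have hJI : J ≤ I := hJ.1.1
  have hJm : J ≤ maximalIdeal R := hJI.trans hIm
  have hJrad : maximalIdeal R ≤ J.radical := by
    obtain ⟨r, hr⟩ := hJ.1.2
    rw [← hI.radical_eq, ← Ideal.radical_pow I (n := r + 1) r.succ_ne_zero]
    refine Ideal.radical_mono ?_
    rw [hr]
    exact Ideal.mul_le_left
  obtain ⟨t, ht⟩ := Ideal.exists_pow_le_of_le_radical_of_fg hJrad
    (IsNoetherian.noetherian (maximalIdeal R))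
  obtain ⟨x, hxm, y, hym, hx, hy⟩ := exists_regular_pair_of_isCohenMacaulayLocalRing hCM hdim
  have hxJ : x ^ t ∈ J := ht (Ideal.pow_mem_pow hxm t)
  have hyJ : y ^ t ∈ J := ht (Ideal.pow_mem_pow hym t)
  obtain ⟨F, n₀, hF0, hLF, hFL, hstab, hIF, hcol⟩ := exists_ratliffRush_filtration hJ.1 hxJ
    (pow_mul_left_injective_at_zero hx t)
  obtain ⟨a, b, hab⟩ := exists_eq_span_pair_of_isMinimalReductionOf hdim hJ hJrad hJm
  have hkos : ∀ u v : R, u * a + v * b = 0 → ∃ w, u = w * b ∧ v = -(w * a) := fun u v huv =>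
    exists_koszul_of_mul_add_mul_eq_zero hx hy (hab ▸ hxJ) (hab ▸ hyJ) huv
  have hJF : ∀ n, J * F n ≤ F (n + 1) := fun n => (Ideal.mul_mono_left hJI).trans (hIF n)
  have hrad := maximalIdeal_le_radical_maximalIdeal_mul_pow hI.radical_eq.ge
  have hfinF : ∀ n, Module.length R (R ⧸ F n) ≠ ⊤ := fun n =>
    length_quotient_ne_top_of_le (hLF n) (length_quotient_ne_top (hrad n))
  have hJfin : Module.length R (R ⧸ J) ≠ ⊤ := length_quotient_ne_top hJrad
  have hJFfin : ∀ n, Module.length R (R ⧸ J * F n) ≠ ⊤ := fun n => by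
    apply length_quotient_ne_top
    rw [Ideal.radical_mul]
    exact le_inf hJrad ((hrad n).trans (Ideal.radical_mono (hLF n)))
  choose H hH using fun n => ENat.ne_top_iff_exists.mp (hfinF n)
  choose v hv using fun n =>
    ENat.ne_top_iff_exists.mp (idealQuotientLength_ne_top (hJF n) (hJFfin n))
  obtain ⟨e, he⟩ := ENat.ne_top_iff_exists.mp hJfin
  have hsum : ∀ N : ℕ, ((∑ n ∈ Finset.range (N + 1), v n : ℕ) : ℤ) =
      (N + 1) * e + H N - H (N + 1) + 1 := by
    subst hab
    exact sum_length_eq_of_ratliffRush hkos hJm hF0 hJF hcol (fun n => (hH n).symm)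
      (fun n => (hv n).symm) he.symm
  have hv0 : ∀ n ≥ n₀, v n = 0 := by
    intro n hn
    have h2 : idealQuotientLength (F (n + 1)) (J * F n) = 0 := by
      rw [← hstab n hn, idealQuotientLength, Submodule.submoduleOf_self]
      exact Module.length_eq_zero_iff.mpr inferInstance
    rw [← hv n] at h2
    exact_mod_cast h2
  set S := ∑ n ∈ Finset.range (n₀ + 1), v n with hS
  have hSn : ∀ n ≥ n₀, ∑ k ∈ Finset.range (n + 1), v k = S := by
    intro n hn
    induction n, hn using Nat.le_induction with
    | base => rfl
    | succ n hn ih => rw [Finset.sum_range_succ, ih, hv0 (n + 1) (by omega), add_zero]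
  -- This identifies `g₀ = λ(R / J)` and `g₁ = S - 1`.
  have hdiff : ∀ n ≥ n₀, (H (n + 1) : ℤ) - H n = e * (n + 1) - (S - 1) := by
    intro n hn
    have := hsum n
    rw [hSn n hn] at this
    linear_combination this
  have hiff := isHilbertCoefficients_two_iff (K := maximalIdeal R) (I := I)
    (fun n hn => by rw [← hFL n hn, hH]) hdiff
  have hbound : ∃ l : ℕ, idealQuotientLength (maximalIdeal R * I) (maximalIdeal R * J) = l ∧
      (kReductionNumber (maximalIdeal R) J I : ℤ) ≤ (S - 1) + 2 - l := by
    have hmJ : J * F 0 = maximalIdeal R * J := by rw [hF0, mul_comm]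
    have hmJI : maximalIdeal R * J ≤ maximalIdeal R * I := Ideal.mul_mono_right hJI
    have hKF : maximalIdeal R * I ≤ F 1 := by simpa using hLF 1
    have hmJfin : Module.length R (R ⧸ maximalIdeal R * J) ≠ ⊤ := hmJ ▸ hJFfin 0
    have hmIfin := length_quotient_ne_top_of_le hmJI hmJfin
    obtain ⟨l, hl⟩ := ENat.ne_top_iff_exists.mp (idealQuotientLength_ne_top hmJI hmJfin)
    obtain ⟨u, hu⟩ := ENat.ne_top_iff_exists.mp (idealQuotientLength_ne_top hKF hmIfin)
    have hv0' : v 0 = u + l := by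
      have := idealQuotientLength_add hKF hmJI hmJfin
      rw [← hl, ← hu, ← hmJ, ← hv 0] at this
      exact_mod_cast this
    obtain ⟨f, hfF, hf⟩ := exists_generators_of_idealQuotientLength_eq u hKF hmIfin hu.symm
    choose f' hfF' hf' using fun n : ℕ => exists_generators_of_idealQuotientLength_eq (v (n + 1))
      (hJF (n + 1)) (hJFfin (n + 1)) (hv (n + 1)).symm
    -- Generators of `F 1 / 𝔪 I` get degree 0 and those of `F (k + 2) / J F (k + 1)` degree `k + 1`;
    -- from `k = n₀` on the quotients vanish. Their number is `S - l`, because only `u = v 0 - l`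
    -- are needed in degree 0.
    let d : Fin u ⊕ (Σ k : Fin n₀, Fin (v (k + 1))) → ℕ := Sum.elim 0 fun i => i.1 + 1
    let m : Fin u ⊕ (Σ k : Fin n₀, Fin (v (k + 1))) → R := Sum.elim f fun i => f' i.1 i.2
    have hcard : Fintype.card (Fin u ⊕ (Σ k : Fin n₀, Fin (v (k + 1)))) + l = S := by
      rw [hS, Finset.sum_range_succ', hv0', Fintype.card_sum, Fintype.card_sigma]
      simp only [Fintype.card_fin, Fin.sum_univ_eq_sum_range (fun k => v (k + 1)) n₀]
      ring
    have hred := mul_pow_card_eq_of_generators hJI F hIF hKF d m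
      (by
        rintro (i | i)
        · exact hfF i
        · exact hfF' _ _)
      (le_sup_span_image_of_generators f hf m _ Sum.inl (fun i => rfl) (fun i => rfl))
      (by
        intro n
        by_cases hn : n < n₀
        · exact le_sup_span_image_of_generators (f' n) (hf' n) m _
            (fun i => Sum.inr ⟨⟨n, hn⟩, i⟩) (fun i => rfl) (fun i => rfl)
        · rw [hstab (n + 1) (by omega)]
          exact le_sup_left)
    have hr : kReductionNumber (maximalIdeal R) J I ≤ _ :=
      (kReductionNumber_isLeast (maximalIdeal R) hJ.1).2 hred
    refine ⟨l, hl.symm, ?_⟩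
    omega
  refine ⟨⟨_, (hiff _).mpr rfl, fun g hg => (hiff g).mp hg⟩, fun g hg => ?_⟩
  have hg1 : g 1 = S - 1 := by rw [(hiff g).mp hg]; rfl
  rw [hg1]
  refine ⟨hbound, fun hmin => ?_⟩
  obtain ⟨l, hl, hle⟩ := hbound
  rw [hmin J hJ] at hl
  have hl1 : l = 1 := by exact_mod_cast hl.symm
  rw [hl1] at hle
  push_cast at hle
  linarith
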